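/- **Setting.** For $g\ge 2$ let $F_g$ be the free group on $g$ letters, and let $|w|$ be the reduced word length of $w\in F_g$. Let $\rho:F_g\hookrightarrow \mathrm{PGL}(2,\mathbf C)$ be an injective homomorphism whose image $\Gamma$ is a Schottky group of rank $g$: $\Gamma$ is generated by Möbius transformations $\gamma_1,\dots,\gamma_g$ for which there are $2g$ Jordan domains $B_1,B_1',\dots,B_g,B_g'$ in $\mathbf P^1(\mathbf C)$ with pairwise disjoint closures, the complement of the union of these closures being connected, such that $\gamma_i$ maps the exterior of $B_i$ onto $B_i'$. Let $\Lambda$ be the limit set of $\Gamma$; then $X=\Gamma\backslash(\mathbf P^1(\mathbf C)-\Lambda)$ is a compact Riemann surface of genus $g$, and every compact Riemann surface of genus $g\ge2$ is of this form. Let $\bar F_g$ be Floyd's group completion of $F_g$: the completion of the Cayley graph, in which the edge between $a$ and $b$ has length $\min\{|a|^{-2},|b|^{-2}\}$ (with $|e|^{-2}:=1$), minus the graph itself. Fix $x_0\in\mathbf P^1(\mathbf C)-\Lambda$ and let $\iota_\rho:\bar F_g\to\Lambda$, $\lim w_i\mapsto\lim\rho(w_i)(x_0)$, be Floyd's homeomorphism.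 For $w\in F_g$ let $\overrightarrow w_\rho\subseteq\Lambda$ be the set of all $\iota_\rho(v)$, where $v\in\bar F_g$ is a limit of reduced words that have $w$ as an initial segment. Let $\mu$ be the Patterson–Sullivan measure on $\Lambda$: a probability measure with $d(\gamma^*\mu)=|\gamma'|^{\delta}\,d\mu$ for all $\gamma\in\Gamma$, where $|\gamma'|$ is the derivative in the spherical metric and $\delta$ is the Hausdorff dimension of $\Lambda$. Let $A=C(\Lambda)$, let $A_n\subseteq A$ be the span of the characteristic functions $\chi_{\overrightarrow w_\rho}$ with $|w|\le n$, and let $A_\infty=\bigcup_n A_n$. Let $H$ be the Hilbert space of the GNS representation of $A$ for the state $\tau(a)=\int_\Lambda a\,d\mu$, let $H_n\subseteq H$ be the subspace given by $A_n$, and let $P_n$ be the orthogonal projection onto $H_n$. Put $$D=\lambda_0P_0+\sum_{n\ge1}\lambda_n(P_n-P_{n-1}),\qquad \lambda_n=(\dim A_n)^3,\qquad \zeta_{a,X}(s)=\mathrm{tr}(a|D|^s)\quad(a\in A_\infty,\ \mathrm{Re}(s)\ll0).$$ **Theorem.** Let $X_1,X_2$ be compact Riemann surfaces of genus $g_1,g_2\ge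 2$, given by $\rho_1,\rho_2$ as above, with Patterson–Sullivan measures $\mu_1,\mu_2$. Suppose that $\zeta_{a,X_1}(s)=\zeta_{a,X_2}(s)$ for all $a\in A_\infty$, in the following sense: $\zeta_{1,X_1}(s)=\zeta_{1,X_2}(s)$ for all $s$ with sufficiently negative real part; and, in case $g_1=g_2=g$, for all $a_1\in A_{\infty,1}$ and $a_2\in A_{\infty,2}$ that correspond under the homeomorphism $\Phi:\Lambda_1\to\Lambda_2$ with $\Phi\circ\iota_{\rho_1}=\iota_{\rho_2}$ (that is, $a_1=a_2\circ\Phi$), one has $\zeta_{a_1,X_1}(s)=\zeta_{a_2,X_2}(s)$ for all $s$ with sufficiently negative real part. Then $g_1=g_2=:g$, and $$\mu_1(\overrightarrow\eta_{\rho_1})=\mu_2(\overrightarrow\eta_{\rho_2})\qquad\text{for all }\eta\in F_g .$$ -/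

import Mathlib

open scoped ComplexOrder MatrixGroups ENNReal Topology
open MeasureTheory Filter Set

noncomputable section

/-! ## The Riemann sphere and the action of `PGL(2, ℂ)` by Möbius transformations -/

/-- The Riemann sphere `P¹(ℂ) = ℂ ∪ {∞}`, with the topology of the one-point compactification. -/
abbrev RSphere : Type := OnePoint ℂ

instance : MeasurableSpace RSphere := borel RSphere

instance : BorelSpace RSphere := ⟨rfl⟩

/-- Homogeneous coordinates: `∞ ↦ (1, 0)` and `z ↦ (z, 1)`. -/
def homCoord (p : RSphere) : Fin 2 → ℂ := p.elim ![1, 0] (fun z => ![z, 1])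

/-- The squared hermitian norm on `ℂ²`. -/
def hermSq (v : Fin 2 → ℂ) : ℝ := ‖v 0‖ ^ 2 + ‖v 1‖ ^ 2

/-- The Möbius action of `PGL(2, ℂ)` on the Riemann sphere as a homomorphism to permutations,
induced from Mathlib's action of `GL(2, ℂ)` on `OnePoint ℂ`. -/
def moebiusHom : PGL(2, ℂ) →* Equiv.Perm RSphere :=
  QuotientGroup.lift (Subgroup.center (GL (Fin 2) ℂ)) (MulAction.toPermHom (GL (Fin 2) ℂ) RSphere)
    (by
      intro z hz
      rw [Matrix.GeneralLinearGroup.center_eq_range_scalar] at hz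
      obtain ⟨u, rfl⟩ := hz
      rw [MonoidHom.mem_ker]
      ext p
      induction p using OnePoint.rec with
      | infty => simp [OnePoint.smul_infty_eq_ite]
      | coe z => simp [OnePoint.smul_some_eq_ite])

instance : MulAction PGL(2, ℂ) RSphere := MulAction.compHom RSphere moebiusHom

/-- For `g ∈ GL(2, ℂ)`, the scaling factor `|g'(p)|` at `p` of the Möbius transformation `g`
for the spherical (chordal) metric: `|det g| ‖v‖² / ‖g v‖²` for homogeneous coordinates `v`
of `p`. -/
def glSphericalDeriv (g : GL (Fin 2) ℂ) (p : RSphere) : ℝ :=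
  ‖(g : Matrix (Fin 2) (Fin 2) ℂ).det‖ * hermSq (homCoord p) /
    hermSq ((g : Matrix (Fin 2) (Fin 2) ℂ).mulVec (homCoord p))

/-- The spherical derivative `|γ'(p)|` of a Möbius transformation `γ ∈ PGL(2, ℂ)`. -/
def sphericalDeriv (γ : PGL(2, ℂ)) : RSphere → ℝ :=
  Quotient.liftOn' γ glSphericalDeriv (by
    intro a b hab
    rw [QuotientGroup.leftRel_apply, Matrix.GeneralLinearGroup.center_eq_range_scalar] at hab
    obtain ⟨u, hu⟩ := hab
    have hb : b = a * Matrix.GeneralLinearGroup.scalar (Fin 2) u := by rw [hu]; group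
    subst hb
    have hu0 : ‖(u : ℂ)‖ ≠ 0 := norm_ne_zero_iff.mpr u.ne_zero
    have key : ∀ v : Fin 2 → ℂ, hermSq (fun i => (u : ℂ) * v i) = ‖(u : ℂ)‖ ^ 2 * hermSq v := by
      intro v
      simp only [hermSq, norm_mul]
      ring
    have hmul : ∀ v : Fin 2 → ℂ,
        ((a * Matrix.GeneralLinearGroup.scalar (Fin 2) u : GL (Fin 2) ℂ) :
          Matrix (Fin 2) (Fin 2) ℂ).mulVec v =
        fun i => (u : ℂ) * ((a : Matrix (Fin 2) (Fin 2) ℂ).mulVec v) i := by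
      intro v
      funext i
      fin_cases i <;> simp [Matrix.mul_apply, Fin.sum_univ_two] <;> ring
    funext p
    simp only [glSphericalDeriv]
    rw [hmul, key]
    simp only [Units.val_mul, Matrix.det_mul, norm_mul]
    have hd : ‖((Matrix.GeneralLinearGroup.scalar (Fin 2) u : GL (Fin 2) ℂ) :
        Matrix (Fin 2) (Fin 2) ℂ).det‖ = ‖(u : ℂ)‖ ^ 2 := by
      simp [sq]
    rw [hd]
    field_simp)

/-- Stereographic embedding of the Riemann sphere as the unit sphere of `ℂ × ℝ = ℝ³`; it induces
the chordal metric. -/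
def stereo (p : RSphere) : WithLp 2 (ℂ × ℝ) :=
  WithLp.toLp 2
    (((2 / hermSq (homCoord p) : ℝ) : ℂ) * (homCoord p 0 * (starRingEnd ℂ) (homCoord p 1)),
      (‖homCoord p 0‖ ^ 2 - ‖homCoord p 1‖ ^ 2) / hermSq (homCoord p))

/-- The Hausdorff dimension, for the chordal metric, of a subset of the Riemann sphere. -/
def sphereDim (S : Set RSphere) : ℝ := (dimH (stereo '' S)).toReal

/-! ## Schottky groups and their limit sets -/

/-- An (open) Jordan domain in the Riemann sphere: a component of the complement of a simple
closed curve, i.e. a connected open set whose boundary is a simple closed curve. -/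
structure IsJordanDomain (B : Set RSphere) : Prop where
  isOpen : IsOpen B
  isConnected : IsConnected B
  exists_curve : ∃ c : Circle → RSphere, Continuous c ∧ Function.Injective c ∧ range c = frontier B

/-- `Γ ⊆ PGL(2, ℂ)` is a Schottky group of rank `g`: it is generated by Möbius transformations
`γ₁, …, γ_g` for which there are `2g` Jordan domains `B (i, true)`, `B (i, false)` with pairwise
disjoint closures, whose complement is a domain, such that `γ i` maps the exterior of
`B (i, false)` onto `B (i, true)`. -/
def IsSchottkyGroup (g : ℕ) (Γ : Subgroup PGL(2, ℂ)) : Prop :=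
  ∃ (γ : Fin g → PGL(2, ℂ)) (B : Fin g × Bool → Set RSphere),
    Subgroup.closure (range γ) = Γ ∧
    (∀ x, IsJordanDomain (B x)) ∧
    (Pairwise fun x y => Disjoint (closure (B x)) (closure (B y))) ∧
    IsConnected (⋃ x, closure (B x))ᶜ ∧
    ∀ i, (fun p : RSphere => γ i • p) '' (closure (B (i, false)))ᶜ = B (i, true)

/-- A representation `ρ : F_g → PGL(2, ℂ)` specifying a Schottky group of rank `g`: it is injective
and its image is a Schottky group of rank `g`. -/
structure IsSchottkyRep {g : ℕ} (ρ : FreeGroup (Fin g) →* PGL(2, ℂ)) : Prop where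
  injective : Function.Injective ρ
  isSchottky : IsSchottkyGroup g ρ.range

/-- `p` is a limit point of `Γ`: there are `z` and a sequence of distinct elements `γ n ∈ Γ` with
`γ n • z → p`. -/
def IsLimitPoint (Γ : Subgroup PGL(2, ℂ)) (p : RSphere) : Prop :=
  ∃ (z : RSphere) (γ : ℕ → PGL(2, ℂ)), Function.Injective γ ∧ (∀ n, γ n ∈ Γ) ∧
    Tendsto (fun n => γ n • z) atTop (𝓝 p)

/-- The limit set `Λ_Γ`: the closed set of limit points of `Γ`. (For a discrete group the set of
limit points is already closed, so that taking the closure does not change it.) -/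
def limitSet (Γ : Subgroup PGL(2, ℂ)) : Set RSphere := closure {p | IsLimitPoint Γ p}

instance (Γ : Subgroup PGL(2, ℂ)) : CompactSpace (limitSet Γ) :=
  isCompact_iff_compactSpace.mp isClosed_closure.isCompact

/-- The probability measure `μ` on `Λ_Γ` is a Patterson-Sullivan measure of `Γ`: it is conformal of
dimension `δ`, the Hausdorff dimension of `Λ_Γ`, i.e. `d(γ^* μ) = |γ'|^δ dμ` for all `γ ∈ Γ`
(`μ` is pushed forward to the sphere to express this). -/
def IsPattersonSullivan (Γ : Subgroup PGL(2, ℂ)) (μ : Measure (limitSet Γ))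
    [IsProbabilityMeasure μ] : Prop :=
  ∀ γ ∈ Γ, ∀ E : Set RSphere, MeasurableSet E →
    μ.map Subtype.val ((fun p => γ • p) '' E) =
      ∫⁻ p in E, ENNReal.ofReal (sphericalDeriv γ p ^ sphereDim (limitSet Γ))
        ∂(μ.map Subtype.val)

/-! ## Floyd's group completion of the free group -/

/-- The vertices of the Cayley graph of the free group, to carry Floyd's metric. -/
def FloydVertex (g : ℕ) : Type := FreeGroup (Fin g)

/-- The Cayley graph of `F_g` for its standard generators: `w` is joined to `w * a`. -/
def cayleyGraph (g : ℕ) : SimpleGraph (FreeGroup (Fin g)) :=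
  SimpleGraph.mulCayley (range FreeGroup.of)

/-- `|w|⁻²`, with value `1` for the empty word; `|w|` is the reduced word length. -/
def wordWeight {g : ℕ} (w : FreeGroup (Fin g)) : ℝ≥0∞ :=
  if w = 1 then 1 else ((w.norm : ℝ≥0∞) ^ 2)⁻¹

/-- The length of the edge between `a` and `b` is `min (|a|⁻², |b|⁻²)`. -/
def edgeLength {g : ℕ} (a b : FreeGroup (Fin g)) : ℝ≥0∞ := min (wordWeight a) (wordWeight b)

/-- The length of a path in the Cayley graph. -/
def walkLength {g : ℕ} {a b : FreeGroup (Fin g)} (p : (cayleyGraph g).Walk a b) : ℝ≥0∞ :=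
  (p.darts.map fun d => edgeLength d.fst d.snd).sum

/-- Floyd's metric: the infimum of the lengths of the paths between two vertices. -/
def floydDist {g : ℕ} (a b : FreeGroup (Fin g)) : ℝ≥0∞ :=
  ⨅ p : (cayleyGraph g).Walk a b, walkLength p

lemma floydDist_self {g : ℕ} (a : FreeGroup (Fin g)) : floydDist a a = 0 :=
  le_antisymm (iInf_le_of_le SimpleGraph.Walk.nil (by simp [walkLength])) zero_le

lemma floydDist_le_swap {g : ℕ} (a b : FreeGroup (Fin g)) : floydDist a b ≤ floydDist b a :=
  le_iInf fun p => iInf_le_of_le p.reverse (by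
    simp [walkLength, SimpleGraph.Walk.darts_reverse, List.map_reverse, List.sum_reverse,
      Function.comp_def, edgeLength, min_comm])

lemma floydDist_triangle {g : ℕ} (a b c : FreeGroup (Fin g)) :
    floydDist a c ≤ floydDist a b + floydDist b c :=
  ENNReal.le_iInf_add_iInf fun p q => iInf_le_of_le (p.append q)
    (by simp [walkLength, SimpleGraph.Walk.darts_append])

instance (g : ℕ) : PseudoEMetricSpace (FloydVertex g) where
  edist a b := floydDist (g := g) a b
  edist_self := floydDist_self (g := g)
  edist_comm a b := le_antisymm (floydDist_le_swap (g := g) a b) (floydDist_le_swap (g := g) b a)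
  edist_triangle := floydDist_triangle (g := g)

/-- The completion of the (vertices of the) Cayley graph for Floyd's metric. -/
abbrev FloydCompletion (g : ℕ) : Type := UniformSpace.Completion (FloydVertex g)

/-- A word as a point of the completed Cayley graph. -/
def floydPoint {g : ℕ} (w : FreeGroup (Fin g)) : FloydCompletion g :=
  ((show FloydVertex g from w : FloydVertex g) : FloydCompletion g)

/-- The group completion `F̄_g`: the points of the completed Cayley graph outside the graph. (The
lengths of the edges tend to zero and bounded parts of the graph are finite, so it suffices to
complete the set of vertices.) -/
def FloydBoundary (g : ℕ) : Type :=
  {v : FloydCompletion g // v ∉ range (floydPoint (g := g))}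

/-- `w ⊆ v` for a reduced word `w` and `v ∈ F̄_g`: `v` is a limit of reduced words that have `w` as
an initial segment. -/
def IsInitialWord {g : ℕ} (w : FreeGroup (Fin g)) (v : FloydBoundary g) : Prop :=
  ∃ u : ℕ → FreeGroup (Fin g), (∀ n, w.toWord <+: (u n).toWord) ∧
    Tendsto (fun n => floydPoint (u n)) atTop (𝓝 v.1)

/-- Floyd's map `ι_ρ : F̄_g → P¹(ℂ)`, `lim w_i ↦ lim ρ(w_i)(x₀)`. -/
def floydMap {g : ℕ} (ρ : FreeGroup (Fin g) →* PGL(2, ℂ)) (x₀ : RSphere) (v : FloydBoundary g) :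
    RSphere :=
  limUnder (comap (floydPoint (g := g)) (𝓝 v.1)) fun w => ρ w • x₀

/-- The set of ends of the word `w` with respect to `ρ`, as a subset of the limit set. -/
def ends {g : ℕ} (ρ : FreeGroup (Fin g) →* PGL(2, ℂ)) (x₀ : RSphere) (w : FreeGroup (Fin g)) :
    Set (limitSet ρ.range) :=
  {p | ∃ v : FloydBoundary g, IsInitialWord w v ∧ floydMap ρ x₀ v = p}

/-! ## Traces -/

/-- The operator `T` on the Hilbert space `H` has trace `t`: in every orthonormal basis the sum of
the diagonal matrix coefficients converges (unconditionally) to `t`. -/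
def HasTrace {H : Type} [NormedAddCommGroup H] [InnerProductSpace ℂ H] (T : H → H) (t : ℂ) :
    Prop :=
  ∀ (ι : Type) (b : HilbertBasis ι ℂ H), HasSum (fun i => inner ℂ (b i) (T (b i))) t

open Classical in
/-- The trace of an operator (and `0` if there is none). -/
def opTrace {H : Type} [NormedAddCommGroup H] [InnerProductSpace ℂ H] (T : H → H) : ℂ :=
  if h : ∃ t, HasTrace T t then h.choose else 0

/-! ## The spectral triple of a filtered commutative `C^*`-algebra with a state -/

section SpectralTriple

variable {X : Type} [TopologicalSpace X] [CompactSpace X] [MeasurableSpace X] [BorelSpace X]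

/-- The state `τ(a) = ∫ a dμ` on `C(X)`. -/
def measureState (μ : Measure X) [IsProbabilityMeasure μ] : C(X, ℂ) →ₚ[ℂ] ℂ :=
  PositiveLinearMap.mk₀
    { toFun := fun a => ∫ x, a x ∂μ
      map_add' := fun a b => by
        simpa using integral_add (a.continuous.integrable_of_hasCompactSupport
          (HasCompactSupport.of_compactSpace a)) (b.continuous.integrable_of_hasCompactSupport
          (HasCompactSupport.of_compactSpace b))
      map_smul' := fun c a => by simpa using integral_const_mul c (fun x => a x) }
    (fun a ha => integral_nonneg (fun x => ha x))

/-- The Hilbert space `H` of the GNS representation of `C(X)` for the state `τ`, the completion of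
`C(X)` for the inner product `⟨a | b⟩ = τ(a^* b)` (conjugate linear in the first entry). -/
abbrev GNSSpace (μ : Measure X) [IsProbabilityMeasure μ] : Type := (measureState μ).GNS

variable (μ : Measure X) [IsProbabilityMeasure μ]
variable (A : ℕ → Submodule ℂ C(X, ℂ)) [∀ n, FiniteDimensional ℂ (A n)]

/-- The canonical map from `C(X)` to `H`. -/
def toGNS : C(X, ℂ) →ₗ[ℂ] GNSSpace μ :=
  (UniformSpace.Completion.toComplₗᵢ (𝕜 := ℂ) (E := (measureState μ).PreGNS)).toLinearMap ∘ₗ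
    (measureState μ).toPreGNS.toLinearMap

/-- The subspace `H_n` of `H` corresponding to `A_n`. -/
def filtH (n : ℕ) : Submodule ℂ (GNSSpace μ) := (A n).map (toGNS μ)

instance (n : ℕ) : FiniteDimensional ℂ (filtH μ A n) :=
  inferInstanceAs (FiniteDimensional ℂ ((A n).map (toGNS μ)))

/-- The projections `Q_0 = P_0` and `Q_n = P_n - P_{n-1}`, where `P_n` is the orthogonal projection
of `H` onto `H_n`. -/
def gradedProj : ℕ → (GNSSpace μ →L[ℂ] GNSSpace μ)
  | 0 => (filtH μ A 0).starProjection
  | n + 1 => (filtH μ A (n + 1)).starProjection - (filtH μ A n).starProjection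

/-- The eigenvalues `λ_n = (dim A_n)³` of the Dirac operator. -/
def diracEigenvalue (A : ℕ → Submodule ℂ C(X, ℂ)) (n : ℕ) : ℝ :=
  (Module.finrank ℂ (A n) : ℝ) ^ 3

/-- The function `f(D) = ∑ f(λ_n) Q_n` of the Dirac operator `D = ∑ λ_n Q_n`, by the functional
calculus. Its natural domain consists of the vectors for which the series converges (a vector
outside of it is sent to `0`); it is all of `H` when `f` is bounded on the spectrum. -/
def diracCalculus (f : ℝ → ℂ) (ξ : GNSSpace μ) : GNSSpace μ :=
  ∑' n, f (diracEigenvalue A n) • gradedProj μ A n ξ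

/-- The Dirac operator `D = λ_0 P_0 + ∑_{n ≥ 1} λ_n (P_n - P_{n-1})`. -/
def diracOp : GNSSpace μ → GNSSpace μ := diracCalculus μ A fun t => (t : ℂ)

/-- The power `|D|^s`. -/
def absDiracPow (s : ℂ) : GNSSpace μ → GNSSpace μ :=
  diracCalculus μ A fun t => ((|t| : ℝ) : ℂ) ^ s

/-- The spectral zeta function `ζ_a(s) = tr(a |D|^s)`; `a` acts through the GNS representation.
The values are meaningful for `s` of sufficiently negative real part. -/
def spectralZeta (a : C(X, ℂ)) (s : ℂ) : ℂ :=
  opTrace fun ξ : GNSSpace μ => (measureState μ).gnsStarAlgHom a (absDiracPow μ A s ξ)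

end SpectralTriple

/-! ## The spectral triple of a Schottky group -/

section Schottky

variable {g : ℕ} (ρ : FreeGroup (Fin g) →* PGL(2, ℂ)) (x₀ : RSphere)

/-- `f` is the characteristic function of the set of ends of the word `w`. -/
def IsCharFun (w : FreeGroup (Fin g)) (f : C(limitSet ρ.range, ℂ)) : Prop :=
  ∀ p, f p = (ends ρ x₀ w).indicator 1 p

/-- The span `A_n` of the characteristic functions of the sets of ends of reduced words of length
at most `n`. -/
def locConst (n : ℕ) : Submodule ℂ C(limitSet ρ.range, ℂ) :=
  Submodule.span ℂ {f | ∃ w : FreeGroup (Fin g), w.norm ≤ n ∧ IsCharFun ρ x₀ w f}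

/-- The algebra `A_∞ = ⋃ A_n`, the span of the characteristic functions of all sets of ends. -/
def locConstAll : Submodule ℂ C(limitSet ρ.range, ℂ) :=
  Submodule.span ℂ {f | ∃ w : FreeGroup (Fin g), IsCharFun ρ x₀ w f}

instance (n : ℕ) : FiniteDimensional ℂ (locConst ρ x₀ n) := by
  have hw : {w : FreeGroup (Fin g) | w.norm ≤ n}.Finite :=
    (List.finite_length_le (Fin g × Bool) n).preimage FreeGroup.toWord_injective.injOn
  refine FiniteDimensional.span_of_finite ℂ ?_
  refine (hw.biUnion (t := fun w => {f | IsCharFun ρ x₀ w f}) fun w _ => ?_).subset ?_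
  · refine Set.Subsingleton.finite fun f hf f' hf' => ?_
    ext p
    rw [hf p, hf' p]
  · rintro f ⟨w, h, hf⟩
    exact mem_biUnion (show w ∈ {w : FreeGroup (Fin g) | w.norm ≤ n} from h) hf

/-- The zeta function `ζ_a(s) = tr(a |D|^s)` of the spectral triple of the Schottky group given by
`ρ`, with Patterson-Sullivan measure `μ`. -/
def schottkyZeta (μ : Measure (limitSet ρ.range)) [IsProbabilityMeasure μ]
    (a : C(limitSet ρ.range, ℂ)) (s : ℂ) : ℂ :=
  spectralZeta μ (locConst ρ x₀) a s

end Schottky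

/-- Equality of two zeta functions: they agree for all `s` of sufficiently negative real part (hence
so do their meromorphic continuations). -/
def ZetaEq (ζ₁ ζ₂ : ℂ → ℂ) : Prop := ∃ σ : ℝ, ∀ s : ℂ, s.re < σ → ζ₁ s = ζ₂ s

/-- For Schottky groups of the same rank, `a₁ ∈ C(Λ₁)` and `a₂ ∈ C(Λ₂)` are identified by the
homeomorphism `Φ : Λ₁ → Λ₂` with `Φ ∘ ι_{ρ₁} = ι_{ρ₂}`: one has `a₁(ι_{ρ₁}(v)) = a₂(ι_{ρ₂}(v))` for
all `v ∈ F̄_g`. -/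
def FloydIdentified {g₁ g₂ : ℕ} (h : g₁ = g₂) (ρ₁ : FreeGroup (Fin g₁) →* PGL(2, ℂ))
    (ρ₂ : FreeGroup (Fin g₂) →* PGL(2, ℂ)) (x₁ x₂ : RSphere)
    (a₁ : C(limitSet ρ₁.range, ℂ)) (a₂ : C(limitSet ρ₂.range, ℂ)) : Prop :=
  ∀ (v : FloydBoundary g₁) (p₁ : limitSet ρ₁.range) (p₂ : limitSet ρ₂.range),
    floydMap ρ₁ x₁ v = p₁ → floydMap ρ₂ x₂ (h ▸ v : FloydBoundary g₂) = p₂ → a₁ p₁ = a₂ p₂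

end

/-! The zeta function is a Dirichlet series: since the `A n` increase, `P_n - P_{n-1}` is the
orthogonal projection onto the complement of `H_{n-1}` in `H_n`, and `ζ_a(s) = ∑ λ_n ^ s * tr(a (P_n
- P_{n-1}))` (`spectralZeta_eq_tsum`). Its first two terms carry the theorem.

Leading term: `A 0` consists of the constants, so `λ_0 = 1` and `H_0` is spanned by the unit vector
`1`; the coefficient is `⟨1, a 1⟩ = ∫ a dμ`. As the `λ_n` increase strictly, `ζ_a(-k) → ∫ a dμ` for
`k → ∞` (`tendsto_schottkyZeta`). For `a` the characteristic function of the ends of `η` the limit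
is the measure of this set, and the characteristic functions for `η` on the two limit sets
correspond under Floyd's maps.

Second term, for `a = 1`: `dim A 1 = 2g`, hence `λ_1 = (2g)³`, with coefficient `dim H_1 - dim H_0`.
This is not zero, because a Patterson-Sullivan measure cannot be concentrated on the ends of a
single letter (`exists_two_letters`). Equal zeta functions with equal leading terms then have equal
second exponents (`not_lt_of_tsum_eq`), so the ranks agree.

The geometric input is that Floyd's map is well defined and injective, so that ends of words are
clopen sets, nested or disjoint like the cylinders of words. Limits are taken along nonprincipal
ultrafilters on the group; two of them give the same limit point iff they contain the same cylinders
(`IsSchottkyRep.eq_iff_sameEnd`). For the free generators of the Schottky group this follows from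
ping-pong and north-south dynamics. But `ρ` may mark the group by any other basis; the two markings
differ by an automorphism of the free group, and this respects ends because cylinders are almost
invariant sets, a notion independent of the basis. -/

noncomputable section

/-! ## Cylinders and ends in free groups -/

namespace FreeGroup

section Words

variable {α : Type*}

/-- The inverse letter. -/
def letterInv (l : α × Bool) : α × Bool := (l.1, !l.2)

lemma letterInv_letterInv (l : α × Bool) : letterInv (letterInv l) = l := by simp [letterInv]

lemma eq_letterInv_iff {a l : α × Bool} : a = letterInv l ↔ ¬ (a.1 = l.1 → a.2 = l.2) := by
  obtain ⟨a, x⟩ := a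
  obtain ⟨l, y⟩ := l
  cases x <;> cases y <;> simp [letterInv]

lemma mk_letter_inv (l : α × Bool) : (mk [l])⁻¹ = mk [letterInv l] := by
  simp [inv_mk, invRev, letterInv]

lemma closure_letters : Subgroup.closure (range fun l : α × Bool => mk [l]) = ⊤ := by
  rw [eq_top_iff, ← closure_range_of]
  refine Subgroup.closure_mono ?_
  rintro _ ⟨a, rfl⟩
  exact ⟨(a, true), rfl⟩

variable [DecidableEq α]

lemma toWord_mk_of_isReduced {L : List (α × Bool)} (h : IsReduced L) : (mk L).toWord = L := by
  rw [toWord_mk, h.reduce_eq]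

lemma toWord_letter (l : α × Bool) : (mk [l]).toWord = [l] :=
  toWord_mk_of_isReduced IsReduced.singleton

/-- Multiplying by a letter on the right either appends the letter or removes its inverse. -/
lemma toWord_mul_letter (u : FreeGroup α) (l : α × Bool) :
    (u * mk [l]).toWord = u.toWord ++ [l] ∨ u.toWord = (u * mk [l]).toWord ++ [letterInv l] := by
  rcases List.eq_nil_or_concat' u.toWord with h | ⟨v, a, h⟩
  · left
    rw [toWord_mul, h, toWord_letter]
    rfl
  · by_cases ha : a = letterInv l
    · right
      have hv : IsReduced v := (h ▸ isReduced_toWord (x := u)).infix (List.prefix_append v [a]).isInfix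
      have : u * mk [l] = mk v := by
        have hu : u = mk v * mk [a] := by rw [mul_mk, ← h, mk_toWord]
        rw [hu, ha, ← mk_letter_inv, inv_mul_cancel_right]
      rw [this, toWord_mk_of_isReduced hv, h, ha]
    · left
      rw [toWord_mul, toWord_letter]
      refine IsReduced.reduce_eq ?_
      have hu : IsReduced u.toWord := isReduced_toWord
      rw [IsReduced, List.isChain_append]
      refine ⟨hu, List.isChain_singleton _, ?_⟩
      intro x hx y hy
      rw [h] at hx
      simp only [List.getLast?_append, List.getLast?_singleton, Option.some_or,
        Option.mem_def, Option.some.injEq, List.head?_cons] at hx hy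
      subst hx hy
      rw [eq_letterInv_iff, not_not] at ha
      exact ha

/-- The words having `w` as an initial segment. -/
def cylinder (w : FreeGroup α) : Set (FreeGroup α) := {u | w.toWord <+: u.toWord}

lemma mem_cylinder_self (w : FreeGroup α) : w ∈ cylinder w := List.prefix_rfl

lemma cylinder_one : cylinder (1 : FreeGroup α) = univ := by
  ext u; simp [cylinder]

lemma norm_le_of_mem_cylinder {w u : FreeGroup α} (h : u ∈ cylinder w) : w.norm ≤ u.norm :=
  h.length_le

lemma cylinder_subset_cylinder {w u : FreeGroup α} (h : u ∈ cylinder w) :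
    cylinder u ⊆ cylinder w := fun _ hv => List.IsPrefix.trans h hv

lemma mem_cylinder_of_mem_of_norm_le {w w' u : FreeGroup α} (h : u ∈ cylinder w)
    (h' : u ∈ cylinder w') (hn : w.norm ≤ w'.norm) : w' ∈ cylinder w :=
  List.prefix_of_prefix_length_le h h' hn

lemma eq_of_mem_cylinder_of_norm_eq {w w' u : FreeGroup α} (h : u ∈ cylinder w)
    (h' : u ∈ cylinder w') (hn : w.norm = w'.norm) : w = w' :=
  toWord_injective ((mem_cylinder_of_mem_of_norm_le h h' hn.le).eq_of_length hn)

/-- The initial segment of length `n`. -/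
def initial (n : ℕ) (u : FreeGroup α) : FreeGroup α := mk (u.toWord.take n)

lemma toWord_initial (n : ℕ) (u : FreeGroup α) : (initial n u).toWord = u.toWord.take n :=
  toWord_mk_of_isReduced (isReduced_toWord.infix (List.take_prefix n _).isInfix)

lemma norm_initial {n : ℕ} {u : FreeGroup α} (h : n ≤ u.norm) : (initial n u).norm = n := by
  rw [norm, toWord_initial, List.length_take]
  exact min_eq_left h

lemma mem_cylinder_initial (n : ℕ) (u : FreeGroup α) : u ∈ cylinder (initial n u) := by
  rw [cylinder, mem_ofPred_eq, toWord_initial]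
  exact List.take_prefix n _

/-- Induction along extensions of a word by letters. -/
lemma cylinder_induction {w : FreeGroup α} {P : FreeGroup α → Prop} (base : P w)
    (step : ∀ v l, v ∈ cylinder w → P v → (v * mk [l]).toWord = v.toWord ++ [l] →
      P (v * mk [l])) {u : FreeGroup α} (hu : u ∈ cylinder w) : P u := by
  obtain ⟨t, ht⟩ := hu
  induction t using List.reverseRecOn generalizing u with
  | nil =>
    rw [List.append_nil] at ht
    rwa [← toWord_injective ht]
  | append_singleton t l ih =>
    rw [← List.append_assoc] at ht
    have hv : IsReduced (w.toWord ++ t) :=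
      (ht ▸ isReduced_toWord (x := u)).infix (List.prefix_append _ [l]).isInfix
    have hw := toWord_mk_of_isReduced hv
    have hu : u = mk (w.toWord ++ t) * mk [l] := by rw [mul_mk, ht, mk_toWord]
    rw [hu]
    refine step _ l ?_ (ih hw.symm) ?_
    · rw [cylinder, mem_ofPred_eq, hw]; exact List.prefix_append _ _
    · rw [← hu, hw, ht]

/-- In the Cayley tree a cylinder is the subtree hanging at `w`; a single edge leaves it, and it
leaves at `w`. -/
lemma eq_of_mem_cylinder_of_mul_letter_notMem {w u : FreeGroup α} {l : α × Bool}
    (hu : u ∈ cylinder w) (h : u * mk [l] ∉ cylinder w) : u = w := by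
  rcases toWord_mul_letter u l with h' | h'
  · exact absurd (List.IsPrefix.trans hu ⟨[l], h'.symm⟩) h
  · rw [cylinder, mem_ofPred_eq, h', List.prefix_concat_iff] at hu
    rcases hu with hu | hu
    · rw [← h'] at hu
      exact (toWord_injective hu).symm
    · exact absurd hu h

lemma mul_letter_eq_of_notMem_cylinder {w u : FreeGroup α} {l : α × Bool}
    (hu : u ∉ cylinder w) (h : u * mk [l] ∈ cylinder w) : u * mk [l] = w := by
  refine eq_of_mem_cylinder_of_mul_letter_notMem (l := letterInv l) h ?_
  rwa [← mk_letter_inv, mul_inv_cancel_right]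

lemma finite_norm_le [Finite α] (n : ℕ) : {u : FreeGroup α | u.norm ≤ n}.Finite :=
  (List.finite_length_le (α × Bool) n).preimage toWord_injective.injOn

end Words

/-! ### Almost invariant sets and the behaviour of ends under change of basis -/

section AlmostInvariant

/-- A subset of a group is almost invariant if right translations change it only by a finite
set. -/
def AlmostInvariant {G : Type*} [Group G] (E : Set G) : Prop :=
  ∀ t : G, {u | ¬ (u ∈ E ↔ u * t ∈ E)}.Finite

/-- Cylinders depend on a basis, almost invariance does not; this is what allows ends to be
transported along isomorphisms. -/
lemma AlmostInvariant.preimage {G H : Type*} [Group G] [Group H] {E : Set H}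
    (hE : AlmostInvariant E) (e : G ≃* H) : AlmostInvariant (e ⁻¹' E) := by
  intro t
  convert (hE (e t)).preimage (e.injective.injOn (s := _)) using 1
  ext u
  simp

/-- The translations that change `E` only by a finite set form a subgroup. -/
lemma AlmostInvariant.of_closure {G : Type*} [Group G] {E S : Set G}
    (hS : Subgroup.closure S = ⊤) (h : ∀ t ∈ S, {u | ¬ (u ∈ E ↔ u * t ∈ E)}.Finite) :
    AlmostInvariant E := by
  intro t
  have ht : t ∈ Subgroup.closure S := hS ▸ Subgroup.mem_top t
  induction ht using Subgroup.closure_induction with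
  | mem x hx => exact h x hx
  | one => simp
  | mul x y _ _ hx hy =>
    refine (hx.union (hy.preimage (mul_left_injective x).injOn)).subset ?_
    intro u hu
    simp only [mem_union, mem_preimage, mem_ofPred_eq, mul_assoc] at hu ⊢
    tauto
  | inv x _ hx =>
    refine (hx.preimage (mul_left_injective x⁻¹).injOn).subset ?_
    intro u hu
    simp only [mem_preimage, mem_ofPred_eq, inv_mul_cancel_right] at hu ⊢
    tauto

variable {α β : Type*} [DecidableEq α] [DecidableEq β]

/-- Right multiplication by a letter is a step along an edge, and only one edge joins a cylinder to
its complement. -/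
lemma almostInvariant_cylinder (w : FreeGroup α) : AlmostInvariant (cylinder w) := by
  refine AlmostInvariant.of_closure closure_letters ?_
  rintro _ ⟨l, rfl⟩
  refine (toFinite {w, w * (mk [l])⁻¹}).subset ?_
  intro u hu
  simp only [mem_insert_iff, mem_singleton_iff]
  by_cases h : u ∈ cylinder w
  · left
    exact eq_of_mem_cylinder_of_mul_letter_notMem (l := l) h (by simp only [mem_ofPred_eq] at hu; tauto)
  · right
    rw [eq_mul_inv_iff_mul_eq]
    exact mul_letter_eq_of_notMem_cylinder h (by simp only [mem_ofPred_eq] at hu; tauto)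

lemma eventually_norm_ge [Finite α] {G : Filter (FreeGroup α)} (hG : G ≤ cofinite) (n : ℕ) :
    ∀ᶠ u in G, n ≤ u.norm := by
  refine hG ?_
  rw [mem_cofinite]
  refine (finite_norm_le n).subset ?_
  intro u hu
  simp only [mem_compl_iff, mem_ofPred_eq, not_le] at hu ⊢
  exact hu.le

/-- Up to a finite set, the group is the finite union of the cylinders of words of length `n`; an
ultrafilter selects one of them. -/
lemma exists_cylinder_mem [Finite α] {𝒰 : Ultrafilter (FreeGroup α)}
    (h𝒰 : (𝒰 : Filter (FreeGroup α)) ≤ cofinite) (n : ℕ) :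
    ∃ w : FreeGroup α, w.norm = n ∧ cylinder w ∈ 𝒰 := by
  have hfin : {w : FreeGroup α | w.norm = n}.Finite :=
    (finite_norm_le n).subset fun w hw => le_of_eq hw
  have : (⋃ w ∈ {w : FreeGroup α | w.norm = n}, cylinder w) ∈ 𝒰 := by
    filter_upwards [eventually_norm_ge h𝒰 n] with u hu
    exact mem_biUnion (norm_initial hu) (mem_cylinder_initial n u)
  rw [Ultrafilter.finite_biUnion_mem_iff hfin] at this
  exact this

/-- Two ultrafilters contain the same cylinders. -/
def SameEnd (𝒰 𝒱 : Ultrafilter (FreeGroup α)) : Prop :=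
  ∀ w : FreeGroup α, cylinder w ∈ 𝒰 ↔ cylinder w ∈ 𝒱

/-- An almost invariant set only depends, near infinity, on long initial segments. -/
lemma AlmostInvariant.exists_norm [Finite α] {E : Set (FreeGroup α)} (hE : AlmostInvariant E) :
    ∃ N : ℕ, ∀ w : FreeGroup α, w.norm = N → ∀ u ∈ cylinder w, (u ∈ E ↔ w ∈ E) := by
  have hfin : (⋃ l : α × Bool, {u | ¬ (u ∈ E ↔ u * mk [l] ∈ E)}).Finite :=
    finite_iUnion fun l => hE _
  obtain ⟨N, hN⟩ := (hfin.image norm).bddAbove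
  refine ⟨N + 1, fun w hw u hu => ?_⟩
  refine cylinder_induction (P := fun u => (u ∈ E ↔ w ∈ E)) Iff.rfl ?_ hu
  intro v l hv ih _
  rw [← ih]
  by_contra hcon
  -- An edge on which membership in `E` changes starts at an exceptional word, of length at most
  -- `N`; but the cylinder of a word of length `N + 1` only contains longer words.
  have h1 : v.norm ≤ N := hN (mem_image_of_mem _ (mem_iUnion.2 ⟨l, fun h => hcon h.symm⟩))
  have h2 := norm_le_of_mem_cylinder hv
  omega

/-- Both ultrafilters contain the cylinder of the same long word, and membership in `E` is constant
on it. -/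
lemma SameEnd.mem_iff [Finite α] {𝒰 𝒱 : Ultrafilter (FreeGroup α)} (h : SameEnd 𝒰 𝒱)
    (h𝒰 : (𝒰 : Filter (FreeGroup α)) ≤ cofinite) {E : Set (FreeGroup α)}
    (hE : AlmostInvariant E) : E ∈ 𝒰 ↔ E ∈ 𝒱 := by
  obtain ⟨N, hN⟩ := hE.exists_norm
  obtain ⟨w, hw, hw𝒰⟩ := exists_cylinder_mem h𝒰 N
  have key : ∀ 𝒲 : Ultrafilter (FreeGroup α), cylinder w ∈ 𝒲 → (E ∈ 𝒲 ↔ w ∈ E) := by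
    intro 𝒲 h𝒲
    constructor
    · intro h
      obtain ⟨u, hu, huE⟩ := 𝒲.nonempty_of_mem (inter_mem h𝒲 h)
      exact (hN w hw u hu).1 huE
    · intro h
      filter_upwards [h𝒲] with u hu
      exact (hN w hw u hu).2 h
  rw [key 𝒰 hw𝒰, key 𝒱 ((h w).1 hw𝒰)]

/-- Isomorphisms of free groups preserve ends. -/
lemma SameEnd.map [Finite α] {𝒰 𝒱 : Ultrafilter (FreeGroup α)} (h : SameEnd 𝒰 𝒱)
    (h𝒰 : (𝒰 : Filter (FreeGroup α)) ≤ cofinite) (e : FreeGroup α ≃* FreeGroup β) :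
    SameEnd (𝒰.map e) (𝒱.map e) := fun w => by
  rw [Ultrafilter.mem_map, Ultrafilter.mem_map]
  exact h.mem_iff h𝒰 ((almostInvariant_cylinder w).preimage e)

lemma map_le_cofinite {X Y : Type*} {f : X → Y} (hf : Function.Injective f) {G : Filter X}
    (hG : G ≤ cofinite) : G.map f ≤ cofinite :=
  (map_mono hG).trans hf.tendsto_cofinite

lemma sameEnd_map_iff [Finite α] [Finite β] {𝒰 𝒱 : Ultrafilter (FreeGroup α)}
    (h𝒰 : (𝒰 : Filter (FreeGroup α)) ≤ cofinite) (e : FreeGroup α ≃* FreeGroup β) :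
    SameEnd (𝒰.map e) (𝒱.map e) ↔ SameEnd 𝒰 𝒱 := by
  refine ⟨fun h => ?_, fun h => h.map h𝒰 e⟩
  have h1 : ((𝒰.map e : Ultrafilter _) : Filter (FreeGroup β)) ≤ cofinite :=
    map_le_cofinite e.injective h𝒰
  have := h.map h1 e.symm
  simpa [Ultrafilter.map_map, Function.comp_def] using this

end AlmostInvariant

end FreeGroup

/-! ## Floyd's completion of the free group -/

section Floyd

open FreeGroup

variable {g : ℕ}

lemma edgeLength_pos (a b : FreeGroup (Fin g)) : 0 < edgeLength a b := by
  have h : ∀ w : FreeGroup (Fin g), 0 < wordWeight w := by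
    intro w
    unfold wordWeight
    split_ifs
    · exact one_pos
    · exact ENNReal.inv_pos.2 (ENNReal.pow_ne_top (ENNReal.natCast_ne_top _))
  exact lt_min (h a) (h b)

/-- An almost invariant set and its complement have positive Floyd distance. -/
lemma exists_floydDist_ge {E : Set (FreeGroup (Fin g))} (hE : AlmostInvariant E) :
    ∃ ε : ℝ≥0∞, 0 < ε ∧ ∀ a b, a ∈ E → b ∉ E → ε ≤ floydDist a b := by
  have hfin : (⋃ i : Fin g, {u | ¬ (u ∈ E ↔ u * of i ∈ E)}).Finite :=
    finite_iUnion fun i => hE _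
  set S := ⋃ i : Fin g, {u | ¬ (u ∈ E ↔ u * of i ∈ E)} with hS
  obtain ⟨T, hT⟩ := (hfin.prod (finite_univ (α := Fin g))).exists_finset_coe
  -- The minimal length of the finitely many edges between `E` and its complement (and `⊤` if there
  -- are none).
  refine ⟨T.inf fun x => edgeLength x.1 (x.1 * of x.2), ?_, ?_⟩
  · rw [Finset.lt_inf_iff (by simp)]
    exact fun x _ => edgeLength_pos _ _
  intro a b ha hb
  refine le_iInf fun p => ?_
  -- A path from `E` to its complement must cross one of these edges, so it is at least as long.
  obtain ⟨d, hd, hd1, hd2⟩ := p.exists_boundary_dart E ha hb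
  have h1 : edgeLength d.fst d.snd ≤ walkLength p :=
    List.single_le_sum (by simp) _ (List.mem_map_of_mem hd)
  refine le_trans ?_ h1
  have hadj := d.adj
  have hadj := (SimpleGraph.mulCayley_adj' _ _ _).1 hadj
  obtain ⟨_, _, ⟨i, rfl⟩, hi | hi⟩ := hadj
  · have hmem : (d.fst, i) ∈ T := by
      rw [← Finset.mem_coe, hT]
      refine ⟨mem_iUnion.2 ⟨i, ?_⟩, mem_univ _⟩
      simp only [mem_ofPred_eq, hi]
      tauto
    refine (Finset.inf_le hmem).trans ?_
    rw [hi]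
  · have hmem : (d.snd, i) ∈ T := by
      rw [← Finset.mem_coe, hT]
      refine ⟨mem_iUnion.2 ⟨i, ?_⟩, mem_univ _⟩
      simp only [mem_ofPred_eq, ← hi]
      tauto
    refine (Finset.inf_le hmem).trans ?_
    simp only [← hi, edgeLength, min_comm, le_refl]

lemma floydDist_mul_letter_le (v : FreeGroup (Fin g)) (l : Fin g × Bool)
    (h : (v * FreeGroup.mk [l]).toWord = v.toWord ++ [l]) :
    floydDist v (v * FreeGroup.mk [l]) ≤ (((v.norm : ℝ≥0∞) + 1) ^ 2)⁻¹ := by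
  have hn : (v * FreeGroup.mk [l]).norm = v.norm + 1 := by
    rw [FreeGroup.norm, h, List.length_append]; rfl
  have hne : v * FreeGroup.mk [l] ≠ 1 := by
    rw [← FreeGroup.norm_eq_zero.ne, hn]; omega
  have hadj : (cayleyGraph g).Adj v (v * FreeGroup.mk [l]) := by
    rw [cayleyGraph, SimpleGraph.mulCayley_adj']
    refine ⟨fun h' => ?_, of l.1, mem_range_self _, ?_⟩
    · rw [← h'] at hn; omega
    · obtain ⟨i, b⟩ := l
      cases b
      · right
        rw [show (FreeGroup.mk [(i, false)]) = (of i)⁻¹ from rfl, inv_mul_cancel_right]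
      · left; rfl
  refine (iInf_le _ hadj.toWalk).trans ?_
  simp only [walkLength, SimpleGraph.Adj.toWalk, SimpleGraph.Walk.darts_cons,
    SimpleGraph.Walk.darts_nil, List.map_cons, List.map_nil, List.sum_cons, List.sum_nil, add_zero]
  refine (min_le_right _ _).trans ?_
  rw [wordWeight, if_neg hne, hn]
  push_cast
  exact le_rfl

/-- The path from `w` to `u` through the intermediate initial segments of `u` has one edge for each
length, weighted by its longer end. -/
lemma floydDist_le_sum {w u : FreeGroup (Fin g)} (hu : u ∈ cylinder w) :
    floydDist w u ≤ ∑ k ∈ Finset.Ico w.norm u.norm, (((k : ℝ≥0∞) + 1) ^ 2)⁻¹ := by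
  refine cylinder_induction (P := fun u => floydDist w u ≤
    ∑ k ∈ Finset.Ico w.norm u.norm, (((k : ℝ≥0∞) + 1) ^ 2)⁻¹) ?_ ?_ hu
  · rw [floydDist_self]; exact zero_le
  · intro v l hv ih h
    have hn : (v * FreeGroup.mk [l]).norm = v.norm + 1 := by
      rw [FreeGroup.norm, h, List.length_append]; rfl
    rw [hn, Finset.sum_Ico_succ_top (norm_le_of_mem_cylinder hv)]
    exact (floydDist_triangle _ v _).trans (add_le_add ih (floydDist_mul_letter_le v l h))

/-- The tail of the series of edge lengths. -/
def floydTail (n : ℕ) : ℝ≥0∞ := ∑' k : ℕ, ((((k + n : ℕ) : ℝ≥0∞) + 1) ^ 2)⁻¹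

lemma tendsto_floydTail : Tendsto floydTail atTop (𝓝 0) := by
  refine ENNReal.tendsto_sum_nat_add (fun k : ℕ => (((k : ℝ≥0∞) + 1) ^ 2)⁻¹) ?_
  have h : Summable fun k : ℕ => (((k : NNReal) + 1) ^ 2)⁻¹ := by
    rw [← NNReal.summable_coe]
    have := (summable_nat_add_iff 1).2 (Real.summable_nat_pow_inv.2 (one_lt_two))
    push_cast at this ⊢
    exact this
  convert ENNReal.tsum_coe_ne_top_iff_summable.2 h using 3 with k
  rw [ENNReal.coe_inv (by positivity)]
  push_cast
  rfl

lemma floydDist_le_tail {w u : FreeGroup (Fin g)} (hu : u ∈ cylinder w) :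
    floydDist w u ≤ floydTail w.norm := by
  refine (floydDist_le_sum hu).trans ?_
  rw [Finset.sum_Ico_eq_sum_range, floydTail]
  refine le_trans (le_of_eq ?_) (ENNReal.sum_le_tsum (Finset.range (u.norm - w.norm)))
  refine Finset.sum_congr rfl fun k _ => ?_
  rw [add_comm w.norm k]

/-- Cylinders of long words have small Floyd diameter, so an ultrafilter containing arbitrarily long
ones is Cauchy. -/
lemma floydDist_le_two_tail {w u u' : FreeGroup (Fin g)} (hu : u ∈ cylinder w)
    (hu' : u' ∈ cylinder w) : floydDist u u' ≤ floydTail w.norm + floydTail w.norm :=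
  (floydDist_triangle u w u').trans (add_le_add
    ((floydDist_le_swap u w).trans (floydDist_le_tail hu)) (floydDist_le_tail hu'))

/-- The filter of neighbourhoods of a boundary point, on the group. -/
def boundaryFilter (v : FloydBoundary g) : Filter (FreeGroup (Fin g)) :=
  comap (floydPoint (g := g)) (𝓝 v.1)

lemma isUniformInducing_floydPoint :
    IsUniformInducing (fun w : FloydVertex g => (floydPoint w : FloydCompletion g)) :=
  UniformSpace.Completion.isUniformInducing_coe (FloydVertex g)

instance (v : FloydBoundary g) : NeBot (boundaryFilter v) :=
  comap_neBot_iff_frequently.2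
    (mem_closure_iff_frequently.1 (UniformSpace.Completion.denseRange_coe (α := FloydVertex g) v.1))

lemma exists_small_of_le_nhds {G : Filter (FreeGroup (Fin g))} [NeBot G] {v : FloydCompletion g}
    (h : map floydPoint G ≤ 𝓝 v) {ε : ℝ≥0∞} (hε : 0 < ε) :
    ∃ t ∈ G, ∀ a ∈ t, ∀ b ∈ t, floydDist a b < ε := by
  have hC : Cauchy (map floydPoint G) := cauchy_nhds.mono h
  have hC' : Cauchy (show Filter (FloydVertex g) from G) :=
    (isUniformInducing_floydPoint.cauchy_map_iff).1 hC
  exact (EMetric.cauchy_iff.1 hC').2 ε hε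

/-- Near a boundary point Floyd distances are smaller than the gap between `E` and its complement,
so only one of the two is met. -/
lemma boundaryFilter_mem_or {E : Set (FreeGroup (Fin g))} (hE : AlmostInvariant E)
    (v : FloydBoundary g) : E ∈ boundaryFilter v ∨ Eᶜ ∈ boundaryFilter v := by
  obtain ⟨ε, hε, h⟩ := exists_floydDist_ge hE
  obtain ⟨t, ht, hlt⟩ := exists_small_of_le_nhds (G := boundaryFilter v) map_comap_le hε
  by_cases hne : (t ∩ E).Nonempty
  · left
    obtain ⟨a, ha, haE⟩ := hne
    filter_upwards [ht] with b hb
    by_contra hbE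
    exact absurd (h a b haE hbE) (not_le.2 (hlt a ha b hb))
  · right
    filter_upwards [ht] with b hb hbE
    exact hne ⟨b, hb, hbE⟩

lemma boundaryFilter_le_cofinite (v : FloydBoundary g) : boundaryFilter v ≤ cofinite := by
  rw [le_cofinite_iff_compl_singleton_mem]
  intro w
  have : ({floydPoint w}ᶜ : Set (FloydCompletion g)) ∈ 𝓝 v.1 :=
    isOpen_compl_singleton.mem_nhds fun h => v.2 ⟨w, h.symm⟩
  filter_upwards [preimage_mem_comap this] with u hu hw
  exact hu (congrArg floydPoint hw)

/-- Together with `exists_floydDist_ge` this says that vertices are isolated for Floyd's metric. -/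
lemma almostInvariant_singleton {G : Type*} [Group G] (w : G) : AlmostInvariant ({w} : Set G) := by
  intro t
  refine (toFinite {w, w * t⁻¹}).subset fun u hu => ?_
  simp only [mem_singleton_iff, mem_ofPred_eq, mem_insert_iff, eq_mul_inv_iff_mul_eq] at hu ⊢
  tauto

/-- Nonprincipal ultrafilters on the free group converge to boundary points. -/
lemma exists_boundary_of_ultrafilter {𝒰 : Ultrafilter (FreeGroup (Fin g))}
    (h𝒰 : (𝒰 : Filter (FreeGroup (Fin g))) ≤ cofinite) :
    ∃ v : FloydBoundary g, (𝒰 : Filter (FreeGroup (Fin g))) ≤ boundaryFilter v := by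
  have hC : Cauchy (show Filter (FloydVertex g) from (𝒰 : Filter (FreeGroup (Fin g)))) := by
    rw [EMetric.cauchy_iff]
    refine ⟨NeBot.ne 𝒰.neBot, fun ε hε => ?_⟩
    have h2 : Tendsto (fun n => floydTail n + floydTail n) atTop (𝓝 0) := by
      simpa using tendsto_floydTail.add tendsto_floydTail
    obtain ⟨n, hn⟩ := ((tendsto_order.1 h2).2 ε hε).exists
    obtain ⟨w, rfl, hw⟩ := exists_cylinder_mem h𝒰 n
    exact ⟨cylinder w, hw, fun a ha b hb => (floydDist_le_two_tail ha hb).trans_lt hn⟩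
  obtain ⟨v, hv⟩ := CompleteSpace.complete
    ((isUniformInducing_floydPoint (g := g)).cauchy_map_iff.2 hC)
  refine ⟨⟨v, ?_⟩, map_le_iff_le_comap.1 hv⟩
  rintro ⟨w, rfl⟩
  obtain ⟨ε, hε, h⟩ := exists_floydDist_ge (almostInvariant_singleton w)
  -- If the limit were a vertex `w`, the join of the ultrafilter with the principal filter at `w`
  -- would still converge, hence contain sets of small diameter. These contain `w` and also other
  -- words, although `w` is isolated.
  obtain ⟨t, ht, hlt⟩ := exists_small_of_le_nhds
    (G := (𝒰 : Filter (FreeGroup (Fin g))) ⊔ pure w)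
    (v := floydPoint w)
    (by rw [Filter.map_sup, Filter.map_pure]; exact sup_le hv (pure_le_nhds _)) hε
  have h3 : ∀ᶠ u in (𝒰 : Filter (FreeGroup (Fin g))), u ≠ w :=
    h𝒰 (finite_singleton w).compl_mem_cofinite
  obtain ⟨u, hu, hne⟩ := ((show ∀ᶠ u in (𝒰 : Filter (FreeGroup (Fin g))), u ∈ t from
    ht.1).and h3).exists
  exact absurd (h w u rfl hne) (not_le.2 (hlt w (mem_pure.1 ht.2) u hu))

/-- The ultrafilters converging to a boundary point have the same end. -/
lemma sameEnd_of_le_boundaryFilter {𝒰 𝒱 : Ultrafilter (FreeGroup (Fin g))} {v : FloydBoundary g}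
    (h𝒰 : (𝒰 : Filter (FreeGroup (Fin g))) ≤ boundaryFilter v)
    (h𝒱 : (𝒱 : Filter (FreeGroup (Fin g))) ≤ boundaryFilter v) : SameEnd 𝒰 𝒱 := by
  intro w
  rcases boundaryFilter_mem_or (almostInvariant_cylinder w) v with h | h
  · exact iff_of_true (h𝒰 h) (h𝒱 h)
  · exact iff_of_false (Ultrafilter.compl_mem_iff_notMem.1 (h𝒰 h))
      (Ultrafilter.compl_mem_iff_notMem.1 (h𝒱 h))

/-- Near `v` either the cylinder or its complement is everything, so a single sequence in the
cylinder decides. Conversely, a sequence in the cylinder is chosen diagonally from sets of the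
filter with diameter tending to zero. -/
lemma isInitialWord_iff {w : FreeGroup (Fin g)} {v : FloydBoundary g} :
    IsInitialWord w v ↔ cylinder w ∈ boundaryFilter v := by
  constructor
  · rintro ⟨u, hu, hlim⟩
    refine (boundaryFilter_mem_or (almostInvariant_cylinder w) v).resolve_right fun h => ?_
    obtain ⟨n, hn⟩ := ((tendsto_comap_iff.2 hlim).eventually h).exists
    exact hn (hu n)
  · intro h
    have hpos : ∀ n : ℕ, (0 : ℝ≥0∞) < ((n : ℝ≥0∞) + 1)⁻¹ := fun n =>
      ENNReal.inv_pos.2 (by finiteness)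
    choose t ht hlt using fun n : ℕ =>
      exists_small_of_le_nhds (G := boundaryFilter v) map_comap_le (hpos n)
    have hs : ∀ n : ℕ, ((⋂ k ∈ Finset.range (n + 1), t k) ∩ cylinder w).Nonempty := fun n =>
      (boundaryFilter v).nonempty_of_mem
        (inter_mem ((biInter_finset_mem _).2 fun k _ => ht k) h)
    choose u hu using hs
    refine ⟨u, fun n => (hu n).2, ?_⟩
    have hut : ∀ N, ∀ᶠ n in atTop, u n ∈ t N := fun N => by
      filter_upwards [eventually_ge_atTop N] with n hn
      exact mem_iInter₂.1 (hu n).1 N (Finset.mem_range.2 (by omega))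
    -- The sequence and the filter are Cauchy jointly, not just separately; hence they have the same
    -- limit `v`.
    have hC : Cauchy (show Filter (FloydVertex g) from map u atTop ⊔ boundaryFilter v) := by
      rw [EMetric.cauchy_iff]
      refine ⟨(NeBot.mono (f := map u atTop) inferInstance le_sup_left).ne, fun ε hε => ?_⟩
      obtain ⟨N, hN⟩ := ENNReal.exists_inv_nat_lt hε.ne'
      refine ⟨t N, ⟨hut N, ht N⟩, fun a ha b hb => (hlt N a ha b hb).trans_le ?_⟩
      exact (ENNReal.inv_le_inv.2 le_self_add).trans hN.le
    obtain ⟨v', hv'⟩ := CompleteSpace.complete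
      ((isUniformInducing_floydPoint (g := g)).cauchy_map_iff.2 hC)
    have h1 : map floydPoint (map u atTop) ≤ 𝓝 v' := (map_mono le_sup_left).trans hv'
    have h2 : map floydPoint (boundaryFilter v) ≤ 𝓝 v' := (map_mono le_sup_right).trans hv'
    have h3 : v.1 = v' := tendsto_nhds_unique (l := boundaryFilter v) (f := floydPoint) map_comap_le h2
    rw [h3]
    exact h1

lemma mem_ultrafilter_iff_isInitialWord {𝒰 : Ultrafilter (FreeGroup (Fin g))}
    {v : FloydBoundary g} (h𝒰 : (𝒰 : Filter (FreeGroup (Fin g))) ≤ boundaryFilter v)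
    (w : FreeGroup (Fin g)) : cylinder w ∈ 𝒰 ↔ IsInitialWord w v := by
  rw [isInitialWord_iff]
  refine ⟨fun h => ?_, fun h => h𝒰 h⟩
  refine (boundaryFilter_mem_or (almostInvariant_cylinder w) v).resolve_right fun h' => ?_
  exact Ultrafilter.compl_mem_iff_notMem.1 (h𝒰 h') h

end Floyd

/-! ## Dynamics of Möbius transformations -/

section Moebius

open Matrix

/-- The point of the Riemann sphere with given homogeneous coordinates. -/
def sphereProj (v : Fin 2 → ℂ) : RSphere :=
  if v 1 = 0 then OnePoint.infty else ((v 0 / v 1 : ℂ) : RSphere)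

lemma homCoord_infty : homCoord OnePoint.infty = ![1, 0] := rfl

lemma homCoord_coe (z : ℂ) : homCoord (z : RSphere) = ![z, 1] := rfl

lemma homCoord_ne_zero (p : RSphere) : homCoord p ≠ 0 := by
  induction p using OnePoint.rec with
  | infty => intro h; simpa [homCoord_infty] using congrFun h 0
  | coe z => intro h; simpa [homCoord_coe] using congrFun h 1

lemma sphereProj_smul {c : ℂ} (hc : c ≠ 0) (v : Fin 2 → ℂ) :
    sphereProj (c • v) = sphereProj v := by
  simp only [sphereProj, Pi.smul_apply, smul_eq_mul, mul_eq_zero, hc, false_or]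
  split_ifs with h
  · rfl
  · rw [mul_div_mul_left _ _ hc]

lemma sphereProj_homCoord (p : RSphere) : sphereProj (homCoord p) = p := by
  induction p using OnePoint.rec with
  | infty => simp [homCoord_infty, sphereProj]
  | coe z => simp [homCoord_coe, sphereProj]

/-- Two vectors are proportional to each other iff they define the same point. -/
lemma eq_sphereProj_iff {v : Fin 2 → ℂ} (hv : v ≠ 0) (p : RSphere) :
    p = sphereProj v ↔ v 1 * homCoord p 0 - v 0 * homCoord p 1 = 0 := by
  have h01 : v 1 = 0 → v 0 ≠ 0 := fun h1 h0 => hv (by ext i; fin_cases i <;> simpa)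
  induction p using OnePoint.rec with
  | infty =>
    simp only [sphereProj, homCoord_infty]
    split_ifs with h <;> simp [h]
  | coe z =>
    simp only [sphereProj, homCoord_coe]
    split_ifs with h
    · simp [h, h01 h]
    · simp only [cons_val_zero, cons_val_one, mul_one, OnePoint.coe_eq_coe, eq_div_iff h]
      rw [sub_eq_zero, mul_comm]

lemma smul_eq_sphereProj (A : GL (Fin 2) ℂ) (p : RSphere) :
    A • p = sphereProj ((A : Matrix (Fin 2) (Fin 2) ℂ) *ᵥ homCoord p) := by
  induction p using OnePoint.rec with
  | infty => simp [OnePoint.smul_infty_eq_ite, homCoord_infty, sphereProj]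
  | coe z => simp [OnePoint.smul_some_eq_ite, homCoord_coe, sphereProj]

lemma continuousAt_sphereProj {v : Fin 2 → ℂ} (hv : v ≠ 0) : ContinuousAt sphereProj v := by
  by_cases h1 : v 1 = 0
  · have h0 : v 0 ≠ 0 := fun h0 => hv (by ext i; fin_cases i <;> simpa)
    have hval : sphereProj v = OnePoint.infty := by simp [sphereProj, h1]
    rw [ContinuousAt, hval, (OnePoint.hasBasis_nhds_infty (X := ℂ)).tendsto_right_iff]
    rintro K ⟨_, hK⟩
    obtain ⟨R, hR⟩ := hK.isBounded.exists_norm_le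
    have hev : ∀ᶠ w : Fin 2 → ℂ in 𝓝 v, R * ‖w 1‖ < ‖w 0‖ := by
      refine (IsOpen.mem_nhds (isOpen_lt (by fun_prop) (by fun_prop)) ?_)
      simpa [h1] using h0
    filter_upwards [hev] with w hw
    by_cases hw1 : w 1 = 0
    · right; simp [sphereProj, hw1]
    · left
      refine ⟨w 0 / w 1, ?_, by simp [sphereProj, hw1]⟩
      intro hmem
      have := hR _ hmem
      rw [norm_div, div_le_iff₀ (norm_pos_iff.2 hw1)] at this
      exact absurd hw (not_lt.2 this)
  · have hev : sphereProj =ᶠ[𝓝 v] fun w => ((w 0 / w 1 : ℂ) : RSphere) := by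
      have : ∀ᶠ w : Fin 2 → ℂ in 𝓝 v, w 1 ≠ 0 :=
        (continuous_apply 1).continuousAt.eventually_ne h1
      filter_upwards [this] with w hw
      simp [sphereProj, hw]
    refine ContinuousAt.congr ?_ hev.symm
    exact OnePoint.continuous_coe.continuousAt.comp
      ((continuous_apply 0).continuousAt.div (continuous_apply 1).continuousAt h1)

/-- Homogeneous coordinates can locally be chosen continuously. -/
lemma exists_local_homCoord (p : RSphere) : ∃ s : RSphere → Fin 2 → ℂ, ContinuousAt s p ∧
    s p = homCoord p ∧ ∀ᶠ p' in 𝓝 p, ∃ c : ℂ, c ≠ 0 ∧ s p' = c • homCoord p' := by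
  induction p using OnePoint.rec with
  | infty =>
    refine ⟨fun p' => p'.elim ![1, 0] fun z => ![1, z⁻¹], ?_, rfl, ?_⟩
    · rw [OnePoint.continuousAt_infty', coclosedCompact_eq_cocompact,
        ← Metric.cobounded_eq_cocompact, tendsto_pi_nhds]
      intro i
      fin_cases i
      · simp
      · simpa using tendsto_inv₀_cobounded (α := ℂ)
    · have : ∀ᶠ p' in 𝓝 (OnePoint.infty : RSphere), p' ≠ ((0 : ℂ) : RSphere) :=
        isOpen_ne.mem_nhds (OnePoint.infty_ne_coe 0)
      filter_upwards [this] with p' hp'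
      induction p' using OnePoint.rec with
      | infty => exact ⟨1, one_ne_zero, by simp [homCoord_infty]⟩
      | coe z =>
        have hz : z ≠ 0 := fun h => hp' (by rw [h])
        exact ⟨z⁻¹, inv_ne_zero hz, by simp [homCoord_coe, hz]⟩
  | coe z =>
    refine ⟨homCoord, ?_, rfl, Eventually.of_forall fun p' => ⟨1, one_ne_zero, by simp⟩⟩
    rw [OnePoint.continuousAt_coe, continuousAt_pi]
    intro i
    fin_cases i
    · exact continuousAt_id
    · exact continuousAt_const

lemma tendsto_mulVec {X : Type*} {l : Filter X} {B : X → Matrix (Fin 2) (Fin 2) ℂ}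
    {w : X → Fin 2 → ℂ} {M : Matrix (Fin 2) (Fin 2) ℂ} {v : Fin 2 → ℂ} (hB : Tendsto B l (𝓝 M))
    (hw : Tendsto w l (𝓝 v)) : Tendsto (fun x => B x *ᵥ w x) l (𝓝 (M *ᵥ v)) := by
  rw [tendsto_pi_nhds]
  intro i
  simp only [mulVec, dotProduct]
  exact tendsto_finsetSum _ fun j _ =>
    (tendsto_pi_nhds.1 (tendsto_pi_nhds.1 hB i) j).mul (tendsto_pi_nhds.1 hw j)

/-- If suitable multiples of matrices converge, so do the Möbius transformations, locally uniformly
where the limit matrix is defined. -/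
lemma tendsto_smul_of_tendsto_matrix {ι : Type*} {l : Filter ι} {A : ι → GL (Fin 2) ℂ} {c : ι → ℂ}
    {M : Matrix (Fin 2) (Fin 2) ℂ} (hc : ∀ i, c i ≠ 0)
    (h : Tendsto (fun i => c i • (A i : Matrix (Fin 2) (Fin 2) ℂ)) l (𝓝 M)) {p : RSphere}
    (hp : M *ᵥ homCoord p ≠ 0) :
    Tendsto (fun x : ι × RSphere => A x.1 • x.2) (l ×ˢ 𝓝 p)
      (𝓝 (sphereProj (M *ᵥ homCoord p))) := by
  obtain ⟨s, hs, hsp, hev⟩ := exists_local_homCoord p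
  have h1 : Tendsto (fun x : ι × RSphere => (c x.1 • (A x.1 : Matrix (Fin 2) (Fin 2) ℂ)) *ᵥ s x.2)
      (l ×ˢ 𝓝 p) (𝓝 (M *ᵥ homCoord p)) := by
    have h3 : Tendsto (fun x : ι × RSphere => c x.1 • (A x.1 : Matrix (Fin 2) (Fin 2) ℂ))
        (l ×ˢ 𝓝 p) (𝓝 M) := h.comp tendsto_fst
    have h4 : Tendsto (fun x : ι × RSphere => s x.2) (l ×ˢ 𝓝 p) (𝓝 (s p)) :=
      hs.tendsto.comp tendsto_snd
    rw [← hsp]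
    exact tendsto_mulVec h3 h4
  refine ((continuousAt_sphereProj hp).tendsto.comp h1).congr' ?_
  filter_upwards [tendsto_snd.eventually hev] with x hx
  obtain ⟨d, hd, hx⟩ := hx
  simp only [Function.comp_apply]
  rw [hx, mulVec_smul, smul_mulVec, smul_smul, sphereProj_smul (mul_ne_zero hd (hc _)),
    smul_eq_sphereProj]

lemma pgl_mk_smul (A : GL (Fin 2) ℂ) (p : RSphere) :
    (ProjGenLinGroup.mk A : PGL(2, ℂ)) • p = A • p := rfl

instance : ContinuousConstSMul PGL(2, ℂ) RSphere where
  continuous_const_smul γ := by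
    obtain ⟨A, rfl⟩ := ProjGenLinGroup.mk_surjective γ
    rw [continuous_iff_continuousAt]
    intro p
    have hp : (A : Matrix (Fin 2) (Fin 2) ℂ) *ᵥ homCoord p ≠ 0 := fun h0 => by
      have hA : IsUnit (A : Matrix (Fin 2) (Fin 2) ℂ) := A.isUnit
      exact homCoord_ne_zero p (mulVec_injective_of_isUnit hA (by rw [h0, mulVec_zero]))
    -- Continuity of a single transformation is the case of a constant family indexed by a point.
    have := tendsto_smul_of_tendsto_matrix (l := pure ()) (A := fun _ : Unit => A)
      (c := fun _ => 1) (fun _ => one_ne_zero) (by simp [tendsto_pure_nhds]) hp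
    have h2 := this.comp ((tendsto_pure.2 (Eventually.of_forall fun _ : RSphere => rfl)).prodMk
      tendsto_id)
    rw [ContinuousAt, pgl_mk_smul, smul_eq_sphereProj]
    exact h2

/-- After rescaling, matrices subconverge to a nonzero limit. -/
lemma exists_rescaled_limit {ι : Type*} (𝒰 : Ultrafilter ι) (A : ι → GL (Fin 2) ℂ) :
    ∃ (c : ι → ℂ) (M : Matrix (Fin 2) (Fin 2) ℂ), (∀ i, c i ≠ 0) ∧ M ≠ 0 ∧
      Tendsto (fun i => c i • (A i : Matrix (Fin 2) (Fin 2) ℂ)) 𝒰 (𝓝 M) := by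
  let B : ι → Fin 2 → Fin 2 → ℂ := fun i => (A i : Matrix (Fin 2) (Fin 2) ℂ)
  have hB : ∀ i, B i ≠ 0 := fun i h => (A i).ne_zero h
  let c : ι → ℂ := fun i => ((‖B i‖⁻¹ : ℝ) : ℂ)
  have hc : ∀ i, c i ≠ 0 := fun i => by
    simpa [c] using hB i
  have hS : ∀ i, c i • B i ∈ Metric.sphere (0 : Fin 2 → Fin 2 → ℂ) 1 := by
    intro i
    rw [mem_sphere_zero_iff_norm, norm_smul, Complex.norm_real, norm_inv, norm_norm,
      inv_mul_cancel₀ (norm_ne_zero_iff.2 (hB i))]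
  obtain ⟨M, hM, hlim⟩ := (isCompact_sphere (0 : Fin 2 → Fin 2 → ℂ) 1).ultrafilter_le_nhds
    (𝒰.map fun i => c i • B i) (by
      rw [le_principal_iff]
      exact mem_map.2 (univ_mem' hS))
  refine ⟨c, M, hc, ?_, hlim⟩
  rintro rfl
  exact ne_zero_of_mem_unit_sphere ⟨_, hM⟩ rfl

/-- A singular nonzero `2 × 2` matrix is a rank one matrix. -/
lemma exists_rank_one {M : Matrix (Fin 2) (Fin 2) ℂ} (hM : M ≠ 0) (hdet : M.det = 0) :
    ∃ v x : Fin 2 → ℂ, v ≠ 0 ∧ x ≠ 0 ∧ (∀ w, M *ᵥ w = (v 1 * w 0 - v 0 * w 1) • x) ∧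
      ∀ w, M.adjugate *ᵥ w = (-(x 1 * w 0 - x 0 * w 1)) • v := by
  obtain ⟨v, hv, hMv⟩ := exists_mulVec_eq_zero_iff.2 hdet
  have hrow : ∀ i, M i 0 * v 0 + M i 1 * v 1 = 0 := fun i => by
    have := congrFun hMv i
    simpa [mulVec, dotProduct, Fin.sum_univ_two] using this
  -- Every row annihilates the kernel vector `v`, so it is a multiple of `(v 1, -v 0)`; the factors
  -- form the vector `x` spanning the image.
  have hx : ∃ x : Fin 2 → ℂ, ∀ i, M i 0 = x i * v 1 ∧ M i 1 = - x i * v 0 := by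
    by_cases h1 : v 1 = 0
    · have h0 : v 0 ≠ 0 := fun h0 => hv (by ext i; fin_cases i <;> simpa)
      refine ⟨fun i => - M i 1 / v 0, fun i => ⟨?_, ?_⟩⟩
      · have := hrow i
        simp only [h1, mul_zero, add_zero, mul_eq_zero, h0, or_false] at this
        simp [h1, this]
      · field_simp
    · refine ⟨fun i => M i 0 / v 1, fun i => ⟨?_, ?_⟩⟩
      · field_simp
      · have := hrow i
        field_simp
        linear_combination this
  obtain ⟨x, hx⟩ := hx
  refine ⟨v, x, hv, ?_, ?_, ?_⟩
  · rintro rfl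
    refine hM ?_
    ext i j
    fin_cases j
    · simpa using (hx i).1
    · simpa using (hx i).2
  · intro w
    ext i
    simp only [mulVec, dotProduct, Fin.sum_univ_two, (hx i).1, (hx i).2, Pi.smul_apply, smul_eq_mul]
    ring
  · intro w
    ext i
    rw [adjugate_fin_two]
    fin_cases i <;>
    · simp only [mulVec, dotProduct, Fin.sum_univ_two, of_apply, cons_val', cons_val_zero,
        cons_val_one, cons_val_fin_one, Pi.smul_apply, smul_eq_mul, (hx 0).1, (hx 0).2, (hx 1).1,
        (hx 1).2, Fin.zero_eta, Fin.mk_one]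
      ring

lemma adjugate_eq_smul_inv (A : GL (Fin 2) ℂ) :
    (A : Matrix (Fin 2) (Fin 2) ℂ).adjugate =
      (A : Matrix (Fin 2) (Fin 2) ℂ).det • ((A⁻¹ : GL (Fin 2) ℂ) : Matrix (Fin 2) (Fin 2) ℂ) := by
  have h : (A : Matrix (Fin 2) (Fin 2) ℂ).adjugate * (A : Matrix (Fin 2) (Fin 2) ℂ) =
    (A : Matrix (Fin 2) (Fin 2) ℂ).det • 1 := adjugate_mul _
  have h2 := congrArg (· * ((A⁻¹ : GL (Fin 2) ℂ) : Matrix (Fin 2) (Fin 2) ℂ)) h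
  simp only [mul_assoc, smul_mul_assoc, one_mul] at h2
  rwa [Units.mul_inv, mul_one] at h2

/-- The transformations `γ i` converge to the constant `c` away from `b`, locally uniformly, and
their inverses converge to `b` away from `c`. -/
structure NorthSouth {ι : Type*} (l : Filter ι) (γ : ι → PGL(2, ℂ)) (b c : RSphere) : Prop where
  tendsto : ∀ p, p ≠ b → Tendsto (fun x : ι × RSphere => γ x.1 • x.2) (l ×ˢ 𝓝 p) (𝓝 c)
  tendsto_inv : ∀ p, p ≠ c → Tendsto (fun x : ι × RSphere => (γ x.1)⁻¹ • x.2) (l ×ˢ 𝓝 p) (𝓝 b)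

lemma NorthSouth.inv {ι : Type*} {l : Filter ι} {γ : ι → PGL(2, ℂ)} {b c : RSphere}
    (h : NorthSouth l γ b c) : NorthSouth l (fun i => (γ i)⁻¹) c b :=
  ⟨h.tendsto_inv, by simpa using h.tendsto⟩

lemma NorthSouth.tendsto_apply {ι : Type*} {l : Filter ι} {γ : ι → PGL(2, ℂ)} {b c p : RSphere}
    (h : NorthSouth l γ b c) (hp : p ≠ b) : Tendsto (fun i => γ i • p) l (𝓝 c) :=
  (h.tendsto p hp).comp (tendsto_id.prodMk (tendsto_const_nhds (x := p)))

/-- A family of Möbius transformations either subconverges to a Möbius transformation or has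
north-south dynamics. -/
lemma exists_northSouth_or {ι : Type*} (𝒰 : Ultrafilter ι) (γ : ι → PGL(2, ℂ)) :
    (∃ b c, NorthSouth (𝒰 : Filter ι) γ b c) ∨
      ∀ p : RSphere, Tendsto (fun x : ι × ι => (γ x.1)⁻¹ • γ x.2 • p) ((𝒰 : Filter ι) ×ˢ 𝒰) (𝓝 p) := by
  choose A hA using fun i => ProjGenLinGroup.mk_surjective (γ i)
  obtain ⟨c, M, hc, hM, hlim⟩ := exists_rescaled_limit 𝒰 A
  have hadj : Tendsto (fun i => (c i * (A i : Matrix (Fin 2) (Fin 2) ℂ).det) •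
      (((A i)⁻¹ : GL (Fin 2) ℂ) : Matrix (Fin 2) (Fin 2) ℂ)) 𝒰 (𝓝 M.adjugate) := by
    have hcont : Continuous fun N : Matrix (Fin 2) (Fin 2) ℂ => N.adjugate :=
      continuous_id.matrix_adjugate
    refine ((hcont.tendsto M).comp hlim).congr fun i => ?_
    simp [adjugate_smul, adjugate_eq_smul_inv, smul_smul]
  have hc' : ∀ i, c i * (A i : Matrix (Fin 2) (Fin 2) ℂ).det ≠ 0 := fun i =>
    mul_ne_zero (hc i) (A i).det_ne_zero
  have hinv : ∀ i, (γ i)⁻¹ = ProjGenLinGroup.mk (A i)⁻¹ := fun i => by rw [← hA i, map_inv]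
  -- A singular limit has rank one, with kernel `v` and image `x`: the transformations tend to `x`
  -- away from `v`. The adjugates represent the inverses, and the adjugate of the limit has kernel
  -- `x` and image `v`.
  by_cases hdet : M.det = 0
  · left
    obtain ⟨v, x, hv, hx, h1, h2⟩ := exists_rank_one hM hdet
    refine ⟨sphereProj v, sphereProj x, ⟨fun p hp => ?_, fun p hp => ?_⟩⟩
    · have hne := mt (eq_sphereProj_iff hv p).2 hp
      have := tendsto_smul_of_tendsto_matrix (p := p) hc hlim
        (by rw [h1]; exact smul_ne_zero hne hx)
      rw [h1, sphereProj_smul hne] at this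
      simpa only [← hA, pgl_mk_smul] using this
    · have hne := neg_ne_zero.2 (mt (eq_sphereProj_iff hx p).2 hp)
      have := tendsto_smul_of_tendsto_matrix (p := p) hc' hadj
        (by rw [h2]; exact smul_ne_zero hne hv)
      rw [h2, sphereProj_smul hne] at this
      simpa only [hinv, pgl_mk_smul] using this
  · right
    intro p
    -- For an invertible limit `M` the products `(γ i)⁻¹ * γ j` are represented by matrices tending
    -- to `M.adjugate * M`, which is scalar.
    have hprod : Tendsto (fun x : ι × ι =>
        ((c x.1 * (A x.1 : Matrix (Fin 2) (Fin 2) ℂ).det) * c x.2) •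
          ((((A x.1)⁻¹ * A x.2 : GL (Fin 2) ℂ)) : Matrix (Fin 2) (Fin 2) ℂ))
        ((𝒰 : Filter ι) ×ˢ 𝒰) (𝓝 (M.adjugate * M)) := by
      refine ((hadj.comp tendsto_fst).mul (hlim.comp tendsto_snd)).congr fun x => ?_
      simp only [Function.comp_apply, smul_mul_smul_comm, Units.val_mul]
    have hMp : (M.adjugate * M) *ᵥ homCoord p = M.det • homCoord p := by
      rw [adjugate_mul, smul_mulVec, one_mulVec]
    have := tendsto_smul_of_tendsto_matrix (p := p)
      (A := fun x : ι × ι => (A x.1)⁻¹ * A x.2)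
      (c := fun x => (c x.1 * (A x.1 : Matrix (Fin 2) (Fin 2) ℂ).det) * c x.2)
      (fun x => mul_ne_zero (hc' x.1) (hc x.2)) hprod
      (by rw [hMp]; exact smul_ne_zero hdet (homCoord_ne_zero p))
    rw [hMp, sphereProj_smul hdet, sphereProj_homCoord] at this
    have h0 : Tendsto (fun x : ι × ι => (x, p)) ((𝒰 : Filter ι) ×ˢ 𝒰)
        (((𝒰 : Filter ι) ×ˢ 𝒰) ×ˢ 𝓝 p) := tendsto_id.prodMk tendsto_const_nhds
    have h3 := this.comp h0
    refine h3.congr fun x => ?_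
    rw [hinv, ← hA x.2]
    simp only [pgl_mk_smul, Function.comp_apply, mul_smul]

end Moebius

/-! ## Limit points of discrete groups -/

section LimitPoints

instance : FirstCountableTopology RSphere :=
  (onePointEquivSphereOfFinrankEq (ι := Fin 3) (V := ℂ)
    (by simp)).isInducing.firstCountableTopology

/-- Translates limits along nonprincipal filters into the sequences of distinct elements by which
limit points are defined; each new term avoids the finitely many earlier ones. -/
lemma exists_injective_seq {X Y : Type*} [TopologicalSpace Y] [FirstCountableTopology Y]
    {𝒰 : Filter X} [NeBot 𝒰] (h𝒰 : 𝒰 ≤ cofinite) {f : X → Y} {y : Y} (h : Tendsto f 𝒰 (𝓝 y)) :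
    ∃ u : ℕ → X, Function.Injective u ∧ Tendsto (fun n => f (u n)) atTop (𝓝 y) := by
  obtain ⟨U, hU⟩ := (𝓝 y).exists_antitone_basis
  obtain ⟨s, hs, hr⟩ := exists_seq_of_forall_finset_exists (α := ℕ × X)
    (fun x => f x.2 ∈ U x.1) (fun x y => x.1 < y.1 ∧ x.2 ≠ y.2) (by
      intro S _
      have h1 : ∀ᶠ x in 𝒰, f x ∈ U (S.sup (fun x => x.1) + 1) := h (hU.mem _)
      have h2 : ∀ᶠ x in 𝒰, x ∉ (Prod.snd '' (S : Set (ℕ × X))) :=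
        h𝒰 (S.finite_toSet.image _).compl_mem_cofinite
      obtain ⟨x, hx1, hx2⟩ := (h1.and h2).exists
      refine ⟨(S.sup (fun x => x.1) + 1, x), hx1, fun z hz => ⟨?_, fun h => ?_⟩⟩
      · exact Nat.lt_succ_of_le (Finset.le_sup (f := fun x : ℕ × X => x.1) hz)
      · exact hx2 ⟨z, hz, h⟩)
  have hmono : StrictMono fun n => (s n).1 := fun m n hmn => (hr m n hmn).1
  refine ⟨fun n => (s n).2, ?_, ?_⟩
  · intro m n hmn
    rcases lt_trichotomy m n with h' | h' | h'
    · exact absurd hmn (hr m n h').2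
    · exact h'
    · exact absurd hmn.symm (hr n m h').2
  · rw [hU.toHasBasis.tendsto_right_iff]
    intro k _
    filter_upwards [eventually_ge_atTop k] with n hn
    exact hU.antitone (hn.trans hmono.le_apply) (hs n)

variable {F : Type*} [Group F] {ρ : F →* PGL(2, ℂ)}

lemma mem_limitSet_of_tendsto {𝒰 : Filter F} [NeBot 𝒰] (hρ : Function.Injective ρ)
    (h𝒰 : 𝒰 ≤ cofinite) {z p : RSphere} (h : Tendsto (fun u => ρ u • z) 𝒰 (𝓝 p)) :
    p ∈ limitSet ρ.range := by
  obtain ⟨u, hu, hlim⟩ := exists_injective_seq h𝒰 h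
  exact subset_closure ⟨z, fun n => ρ (u n), hρ.comp hu, fun n => ⟨u n, rfl⟩, hlim⟩

/-- Some point has a neighbourhood containing no other point of its orbit. -/
def HasWanderingPoint (ρ : F →* PGL(2, ℂ)) : Prop :=
  ∃ r : RSphere, ∃ U : Set RSphere, U ∈ 𝓝 r ∧ ∀ u : F, ρ u • r ∈ U → u = 1

/-- In the other alternative of `exists_northSouth_or`, nontrivial elements `(f i)⁻¹ * f j` would
move the wandering point into its neighbourhood `U`. -/
lemma HasWanderingPoint.exists_northSouth (hd : HasWanderingPoint ρ) {ι : Type*}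
    (𝒰 : Ultrafilter ι) (h𝒰 : (𝒰 : Filter ι) ≤ cofinite) {f : ι → F}
    (hf : Function.Injective f) : ∃ b c, NorthSouth (𝒰 : Filter ι) (fun i => ρ (f i)) b c := by
  refine (exists_northSouth_or 𝒰 fun i => ρ (f i)).resolve_right fun h => ?_
  obtain ⟨r, U, hU, hr⟩ := hd
  have h1 := ((h r).eventually hU).curry
  obtain ⟨i, hi⟩ := h1.exists
  have h2 : ∀ᶠ j in (𝒰 : Filter ι), j ≠ i := h𝒰 (finite_singleton i).compl_mem_cofinite
  obtain ⟨j, hj, hne⟩ := (hi.and h2).exists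
  rw [← mul_smul, ← map_inv, ← map_mul] at hj
  exact hne (hf (inv_mul_eq_one.1 (hr _ hj))).symm

lemma exists_ne_of_mem_nhds {U : Set RSphere} {r : RSphere} (hU : U ∈ 𝓝 r) (q : RSphere) :
    ∃ p ∈ U, p ≠ q := by
  by_cases h : r = q
  · subst h
    have h1 : ∀ᶠ p in 𝓝[≠] r, p ∈ U := nhdsWithin_le_nhds hU
    exact (h1.and self_mem_nhdsWithin).exists
  · exact ⟨r, mem_of_mem_nhds hU, h⟩

lemma NorthSouth.mem_limitSet (hρ : Function.Injective ρ) {𝒰 : Filter F} [NeBot 𝒰]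
    (h𝒰 : 𝒰 ≤ cofinite) {b c : RSphere} (h : NorthSouth 𝒰 (fun u => ρ u) b c) :
    c ∈ limitSet ρ.range := by
  obtain ⟨p, _, hp⟩ := exists_ne_of_mem_nhds (univ_mem (f := 𝓝 b)) b
  exact mem_limitSet_of_tendsto hρ h𝒰 (h.tendsto_apply hp)

lemma NorthSouth.mem_limitSet' (hρ : Function.Injective ρ) {𝒰 : Filter F} [NeBot 𝒰]
    (h𝒰 : 𝒰 ≤ cofinite) {b c : RSphere} (h : NorthSouth 𝒰 (fun u => ρ u) b c) :
    b ∈ limitSet ρ.range := by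
  obtain ⟨p, _, hp⟩ := exists_ne_of_mem_nhds (univ_mem (f := 𝓝 c)) c
  have := h.inv.tendsto_apply hp
  simp only [← map_inv] at this
  exact mem_limitSet_of_tendsto (𝒰 := map (·⁻¹) 𝒰) hρ
    (FreeGroup.map_le_cofinite inv_injective h𝒰) this

/-- Nonprincipal ultrafilters on the group define limit points. -/
lemma HasWanderingPoint.exists_limit (hd : HasWanderingPoint ρ) (hρ : Function.Injective ρ)
    {x₀ : RSphere} (hx₀ : x₀ ∉ limitSet ρ.range) (𝒰 : Ultrafilter F)
    (h𝒰 : (𝒰 : Filter F) ≤ cofinite) :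
    ∃ p ∈ limitSet ρ.range, Tendsto (fun u => ρ u • x₀) 𝒰 (𝓝 p) := by
  obtain ⟨b, c, h⟩ := hd.exists_northSouth 𝒰 h𝒰 (f := id) Function.injective_id
  exact ⟨c, h.mem_limitSet hρ h𝒰, h.tendsto_apply fun hb => hx₀ (hb ▸ h.mem_limitSet' hρ h𝒰)⟩

/-- Every limit point is defined by a nonprincipal ultrafilter on the group. -/
lemma HasWanderingPoint.exists_ultrafilter (hd : HasWanderingPoint ρ) (hρ : Function.Injective ρ)
    {x₀ : RSphere} (hx₀ : x₀ ∉ limitSet ρ.range) {p : RSphere} (hp : p ∈ limitSet ρ.range) :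
    ∃ 𝒰 : Ultrafilter F, (𝒰 : Filter F) ≤ cofinite ∧ Tendsto (fun u => ρ u • x₀) 𝒰 (𝓝 p) := by
  -- The cluster points of the orbit of `x₀` form a closed set, so only actual limit points need to
  -- be treated. These may come from a base point `z` other than `x₀`.
  set S : Set RSphere := {p | MapClusterPt p cofinite fun u => ρ u • x₀} with hS
  have hmem : ∀ p, p ∈ S ↔ ∃ 𝒰 : Ultrafilter F, (𝒰 : Filter F) ≤ cofinite ∧
      Tendsto (fun u => ρ u • x₀) 𝒰 (𝓝 p) := fun p => mapClusterPt_iff_ultrafilter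
  have hclosed : IsClosed S := isClosed_setOfPred_clusterPt
  rw [← hmem]
  refine closure_minimal ?_ hclosed hp
  rintro p ⟨z, γ, hγ, hγΓ, hlim⟩
  choose u hu using hγΓ
  have huinj : Function.Injective u := fun m n h => hγ (by rw [← hu m, ← hu n, h])
  have hh : ((hyperfilter ℕ : Ultrafilter ℕ) : Filter ℕ) ≤ cofinite := hyperfilter_le_cofinite
  have h𝒰 : (((hyperfilter ℕ).map u : Ultrafilter F) : Filter F) ≤ cofinite :=
    FreeGroup.map_le_cofinite huinj hh
  obtain ⟨b, c, h⟩ := hd.exists_northSouth ((hyperfilter ℕ).map u) h𝒰 (f := id)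
    Function.injective_id
  have hb := h.mem_limitSet' hρ h𝒰
  have hc := h.mem_limitSet hρ h𝒰
  have hlim' : Tendsto (fun n => ρ (u n) • z) (hyperfilter ℕ) (𝓝 p) := by
    simp only [hu]
    exact hlim.mono_left Nat.hyperfilter_le_atTop
  by_cases hz : z = b
  -- The base point is the repelling point, where the dynamics gives no information. But it is
  -- itself a cluster point of the orbit of `x₀`, along the inverses, and `S` is closed and
  -- invariant under the group.
  · subst hz
    have hzS : z ∈ S := by
      rw [hmem]
      have h2 := h.inv.tendsto_apply (p := x₀) fun hc' => hx₀ (hc' ▸ hc)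
      simp only [← map_inv] at h2
      exact ⟨((hyperfilter ℕ).map u).map (·⁻¹), FreeGroup.map_le_cofinite inv_injective h𝒰, h2⟩
    refine hclosed.mem_of_tendsto hlim' (Eventually.of_forall fun n => ?_)
    rw [hmem] at hzS ⊢
    obtain ⟨𝒱, h𝒱, hz⟩ := hzS
    refine ⟨𝒱.map (u n * ·), FreeGroup.map_le_cofinite (mul_right_injective (u n)) h𝒱, ?_⟩
    rw [Ultrafilter.coe_map, tendsto_map'_iff]
    refine (hz.const_smul (ρ (u n))).congr fun v => ?_
    rw [Function.comp_apply, map_mul, mul_smul]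
  · have hpc : p = c := tendsto_nhds_unique hlim' (tendsto_map'_iff.1 (h.tendsto_apply hz))
    rw [hmem, hpc]
    exact ⟨_, h𝒰, h.tendsto_apply fun hb' => hx₀ (hb' ▸ hb)⟩

end LimitPoints

/-! ## Ping-pong and the ends of a Schottky group -/

section PingPong

open FreeGroup

variable {g : ℕ}

/-- Ping-pong tables of closed sets indexed by the letters. -/
structure PingPong (σ : FreeGroup (Fin g) →* PGL(2, ℂ)) (C : Fin g × Bool → Set RSphere) :
    Prop where
  isClosed : ∀ l, IsClosed (C l)
  disjoint : Pairwise fun l l' => Disjoint (C l) (C l')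
  smul_mem : ∀ l p, p ∉ C (letterInv l) → σ (FreeGroup.mk [l]) • p ∈ C l
  exists_notMem : ∃ r, ∀ l, r ∉ C l

namespace PingPong

variable {σ : FreeGroup (Fin g) →* PGL(2, ℂ)} {C : Fin g × Bool → Set RSphere}

/-- Ping-pong, from the last letter to the first: the rest of the word brings `r` into `C l'`, which
is disjoint from `C (letterInv l)` as `l` and `l'` do not cancel. -/
lemma smul_mem_of_toWord (h : PingPong σ C) {r : RSphere} (hr : ∀ l, r ∉ C l)
    {u : FreeGroup (Fin g)} {l : Fin g × Bool} {t : List (Fin g × Bool)}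
    (hu : u.toWord = l :: t) : σ u • r ∈ C l := by
  induction t generalizing u l with
  | nil =>
    rw [← FreeGroup.mk_toWord (x := u), hu]
    exact h.smul_mem l r (hr _)
  | cons l' t ih =>
    have hred : IsReduced (l :: l' :: t) := hu ▸ isReduced_toWord
    have h1 := ih (u := FreeGroup.mk (l' :: t))
      (toWord_mk_of_isReduced (isReduced_cons_cons.1 hred).2)
    have hne : l ≠ letterInv l' := by
      rw [ne_eq, eq_letterInv_iff, not_not]
      exact (isReduced_cons_cons.1 hred).1
    rw [← FreeGroup.mk_toWord (x := u), hu, ← List.singleton_append, ← FreeGroup.mul_mk, _root_.map_mul,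
      mul_smul]
    refine h.smul_mem l _ fun h2 => ?_
    refine disjoint_left.1 (h.disjoint (i := l') (j := letterInv l) ?_) h1 h2
    rintro rfl
    exact hne (letterInv_letterInv l).symm

lemma smul_mem_iUnion (h : PingPong σ C) {r : RSphere} (hr : ∀ l, r ∉ C l)
    {u : FreeGroup (Fin g)} (hu : u ≠ 1) : ∃ l, σ u • r ∈ C l := by
  obtain ⟨l, t, hlt⟩ := List.exists_cons_of_ne_nil (mt FreeGroup.toWord_eq_nil_iff.1 hu)
  exact ⟨l, h.smul_mem_of_toWord hr hlt⟩

lemma isClosed_iUnion (h : PingPong σ C) : IsClosed (⋃ l, C l) :=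
  isClosed_iUnion_of_finite h.isClosed

lemma injective (h : PingPong σ C) : Function.Injective σ := by
  rw [injective_iff_map_eq_one]
  intro u hu
  by_contra hne
  obtain ⟨r, hr⟩ := h.exists_notMem
  obtain ⟨l, hl⟩ := h.smul_mem_iUnion hr hne
  rw [hu, one_smul] at hl
  exact hr l hl

lemma hasWanderingPoint (h : PingPong σ C) : HasWanderingPoint σ := by
  obtain ⟨r, hr⟩ := h.exists_notMem
  refine ⟨r, (⋃ l, C l)ᶜ, h.isClosed_iUnion.isOpen_compl.mem_nhds (by simpa using hr), ?_⟩
  intro u hu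
  by_contra hne
  exact hu (mem_iUnion.2 (h.smul_mem_iUnion hr hne))

lemma exists_notMem_ne (h : PingPong σ C) (q : RSphere) : ∃ r, (∀ l, r ∉ C l) ∧ r ≠ q := by
  obtain ⟨r, hr⟩ := h.exists_notMem
  obtain ⟨p, hp, hpq⟩ := exists_ne_of_mem_nhds
    (h.isClosed_iUnion.isOpen_compl.mem_nhds (x := r) (by simpa using hr)) q
  exact ⟨p, by simpa using hp, hpq⟩

lemma toWord_inv_mul {w u : FreeGroup (Fin g)} {s : List (Fin g × Bool)}
    (h : u.toWord = w.toWord ++ s) : (w⁻¹ * u).toWord = s := by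
  have hs : IsReduced s :=
    (h ▸ isReduced_toWord (x := u)).infix (List.suffix_append w.toWord s).isInfix
  have : w⁻¹ * u = FreeGroup.mk s := by
    rw [inv_mul_eq_iff_eq_mul, ← FreeGroup.mk_toWord (x := u), h, ← FreeGroup.mul_mk,
      FreeGroup.mk_toWord]
  rw [this, toWord_mk_of_isReduced hs]

/-- Removing the initial segment `w` from `u` leaves a reduced word that begins with `l`. -/
lemma inv_smul_mem (h : PingPong σ C) {r : RSphere} (hr : ∀ l, r ∉ C l)
    {w w' u : FreeGroup (Fin g)} {l : Fin g × Bool} (hw : w'.toWord = w.toWord ++ [l])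
    (hu : u ∈ cylinder w') : σ (w⁻¹ * u) • r ∈ C l := by
  obtain ⟨t, ht⟩ := hu
  refine h.smul_mem_of_toWord hr (t := t) (toWord_inv_mul ?_)
  rw [← ht, hw, List.append_assoc, List.singleton_append]

lemma exists_letter {w w' : FreeGroup (Fin g)} {n : ℕ} (hw : w.norm = n) (hw' : w'.norm = n + 1)
    (h : w' ∈ cylinder w) : ∃ l, w'.toWord = w.toWord ++ [l] := by
  obtain ⟨s, hs⟩ := h
  have : s.length = 1 := by
    have := congrArg List.length hs
    rw [List.length_append] at this
    simp only [FreeGroup.norm] at hw hw'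
    omega
  obtain ⟨l, rfl⟩ := List.length_eq_one_iff.1 this
  exact ⟨l, hs.symm⟩

/-- Two ultrafilters with different ends have different limits. -/
lemma sameEnd_of_tendsto (h : PingPong σ C) {r r' : RSphere} (hr : ∀ l, r ∉ C l)
    (hr' : ∀ l, r' ∉ C l)
    {𝒰 𝒱 : Ultrafilter (FreeGroup (Fin g))}
    (h𝒰 : (𝒰 : Filter (FreeGroup (Fin g))) ≤ cofinite)
    (h𝒱 : (𝒱 : Filter (FreeGroup (Fin g))) ≤ cofinite) {p : RSphere}
    (hp : Tendsto (fun u => σ u • r) 𝒰 (𝓝 p)) (hp' : Tendsto (fun u => σ u • r') 𝒱 (𝓝 p)) :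
    SameEnd 𝒰 𝒱 := by
  have key : ∀ n : ℕ, ∀ w w' : FreeGroup (Fin g), w.norm = n → w'.norm = n →
      cylinder w ∈ 𝒰 → cylinder w' ∈ 𝒱 → w = w' := by
    intro n
    induction n with
    | zero =>
      intro w w' hw hw' _ _
      rw [FreeGroup.norm_eq_zero.1 hw, FreeGroup.norm_eq_zero.1 hw']
    | succ n ih =>
      intro w w' hw hw' hw𝒰 hw𝒱
      have hi : w ∈ cylinder (initial n w) := mem_cylinder_initial n w
      have hi' : w' ∈ cylinder (initial n w') := mem_cylinder_initial n w'
      have hn : (initial n w).norm = n := norm_initial (by omega)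
      have hn' : (initial n w').norm = n := norm_initial (by omega)
      have heq := ih _ _ hn hn' (mem_of_superset hw𝒰 (cylinder_subset_cylinder hi))
        (mem_of_superset hw𝒱 (cylinder_subset_cylinder hi'))
      obtain ⟨l, hl⟩ := exists_letter hn hw hi
      obtain ⟨l', hl'⟩ := exists_letter hn' hw' hi'
      rw [← heq] at hl'
      -- Pulled back by the common initial segment, the limit `p` lies in the closed set of the next
      -- letter. These sets are disjoint, so `p` determines the letter.
      have hmem : ∀ {𝒲 : Ultrafilter (FreeGroup (Fin g))} {w : FreeGroup (Fin g)} {v l s},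
          (∀ l, s ∉ C l) →
          w.toWord = v.toWord ++ [l] → cylinder w ∈ 𝒲 →
          Tendsto (fun u => σ u • s) 𝒲 (𝓝 p) → σ v⁻¹ • p ∈ C l := by
        intro 𝒲 w v l s hs hwl hw hlim
        refine (h.isClosed l).mem_of_tendsto (hlim.const_smul (σ v⁻¹)) ?_
        filter_upwards [hw] with u hu
        rw [← mul_smul, ← _root_.map_mul]
        exact h.inv_smul_mem hs hwl hu
      have hll : l = l' := by
        by_contra hne
        exact disjoint_left.1 (h.disjoint hne) (hmem hr hl hw𝒰 hp) (hmem hr' hl' hw𝒱 hp')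
      exact FreeGroup.toWord_injective (by rw [hl, hl', hll])
  intro w
  constructor
  · intro hw
    obtain ⟨w', hn, hw'⟩ := exists_cylinder_mem h𝒱 w.norm
    rwa [key _ w w' rfl hn hw hw']
  · intro hw
    obtain ⟨w', hn, hw'⟩ := exists_cylinder_mem h𝒰 w.norm
    rwa [← key _ w' w hn rfl hw' hw]

/-- An ultrafilter converges to a limit depending only on its end. -/
lemma exists_end_limit (h : PingPong σ C) {𝒰 : Ultrafilter (FreeGroup (Fin g))}
    (h𝒰 : (𝒰 : Filter (FreeGroup (Fin g))) ≤ cofinite) :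
    ∃ c, ∀ (r : RSphere) (𝒱 : Ultrafilter (FreeGroup (Fin g))) (p : RSphere), (∀ l, r ∉ C l) →
      SameEnd 𝒰 𝒱 → Tendsto (fun u => σ u • r) 𝒱 (𝓝 p) → p = c := by
  -- The end as an infinite word: `w n` is its initial segment of length `n`, and `a n` is the
  -- letter that follows it.
  choose w hwn hw using fun n => exists_cylinder_mem h𝒰 n
  have hsub : ∀ n, w (n + 1) ∈ cylinder (w n) := fun n => by
    obtain ⟨u, hu, hu'⟩ := 𝒰.nonempty_of_mem (inter_mem (hw n) (hw (n + 1)))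
    exact mem_cylinder_of_mem_of_norm_le hu hu' (by rw [hwn, hwn]; omega)
  choose a ha using fun n => exists_letter (hwn n) (hwn (n + 1)) (hsub n)
  have hinj : Function.Injective fun n => w (n + 1) := fun m n hmn => by
    have := congrArg FreeGroup.norm hmn
    simp only [hwn] at this
    omega
  obtain ⟨b, c, hbc⟩ := h.hasWanderingPoint.exists_northSouth (hyperfilter ℕ)
    hyperfilter_le_cofinite hinj
  -- There are finitely many pairs of letters, so along the ultrafilter the last letter `l` of `w (n
  -- + 1)` and its successor `l'` are constant.
  obtain ⟨⟨l, l'⟩, hl⟩ := ((hyperfilter ℕ).map fun n => (a n, a (n + 1))).eq_pure_of_finite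
  have hl : ∀ᶠ n in (hyperfilter ℕ : Filter ℕ), a n = l ∧ a (n + 1) = l' := by
    have : {(l, l')} ∈ (hyperfilter ℕ).map fun n => (a n, a (n + 1)) := by
      rw [hl]; exact mem_pure.2 rfl
    filter_upwards [Ultrafilter.mem_map.1 this] with n hn
    exact Prod.mk_inj.1 hn
  -- The repelling point is a limit of points moved by the words `(w (n + 1))⁻¹`, which begin with
  -- the inverse of `l`.
  have hb : b ∈ C (letterInv l) := by
    obtain ⟨q, hq, hqc⟩ := h.exists_notMem_ne c
    refine (h.isClosed _).mem_of_tendsto (hbc.inv.tendsto_apply hqc) ?_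
    filter_upwards [hl] with n hn
    rw [← _root_.map_inv]
    refine h.smul_mem_of_toWord hq (t := invRev (w n).toWord) ?_
    rw [toWord_inv, ha, hn.1, invRev_append]
    rfl
  have hbl' : b ∉ C l' := by
    obtain ⟨n, hn⟩ := hl.exists
    have hred : IsReduced ((w n).toWord ++ [a n] ++ [a (n + 1)]) := by
      rw [← ha, ← ha]; exact isReduced_toWord
    have hred2 : IsReduced [a n, a (n + 1)] :=
      hred.infix ⟨(w n).toWord, [], by simp⟩
    have hne : a n ≠ letterInv (a (n + 1)) := by
      rw [ne_eq, eq_letterInv_iff, not_not]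
      exact (isReduced_cons_cons.1 hred2).1
    rw [hn.1, hn.2] at hne
    refine disjoint_left.1 (h.disjoint (i := letterInv l) (j := l') ?_) hb
    rintro rfl
    exact hne (letterInv_letterInv l).symm
  refine ⟨c, fun r 𝒱 p hr hend hp => ?_⟩
  by_contra hpc
  obtain ⟨N, hN, hNclosed, hNp⟩ := exists_mem_nhds_isClosed_subset
    (isOpen_compl_singleton.mem_nhds (show c ∈ ({p}ᶜ : Set RSphere) from fun h => hpc h.symm))
  -- The compact set `C l'` avoids the repelling point, so it is contracted uniformly to `c`. Every
  -- word with initial segment `w (n + 2)` first moves `r` into `C l'` and then applies `w (n + 1)`.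
  have hunif : ∀ᶠ n in (hyperfilter ℕ : Filter ℕ), ∀ y ∈ C l', σ (w (n + 1)) • y ∈ N := by
    have h1 : {x : ℕ × RSphere | σ (w (x.1 + 1)) • x.2 ∈ N} ∈
        (hyperfilter ℕ : Filter ℕ) ×ˢ 𝓝ˢ (C l') := by
      refine (h.isClosed l').isCompact.mem_prod_nhdsSet_of_forall fun y hy => ?_
      exact hbc.tendsto y (fun hyb => hbl' (hyb ▸ hy)) hN
    obtain ⟨s, hs, t, ht, hst⟩ := mem_prod_iff.1 h1
    filter_upwards [hs] with n hn y hy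
    exact hst (mk_mem_prod hn (subset_of_mem_nhdsSet ht hy))
  obtain ⟨n, hn, hnl⟩ := (hunif.and hl).exists
  refine hNp (hNclosed.mem_of_tendsto hp ?_) rfl
  filter_upwards [(hend _).1 (hw (n + 1 + 1))] with u hu
  have h2 := h.inv_smul_mem hr (ha (n + 1)) hu
  rw [hnl.2] at h2
  have h3 := hn _ h2
  rwa [← mul_smul, ← _root_.map_mul, mul_inv_cancel_left] at h3

end PingPong

/-- Schottky groups play ping-pong. -/
lemma IsSchottkyGroup.exists_pingPong {Γ : Subgroup PGL(2, ℂ)} (h : IsSchottkyGroup g Γ) :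
    ∃ σ : FreeGroup (Fin g) →* PGL(2, ℂ), σ.range = Γ ∧ ∃ C, PingPong σ C := by
  obtain ⟨γ, B, hΓ, -, hdisj, hconn, hmap⟩ := h
  refine ⟨FreeGroup.lift γ, by rw [FreeGroup.range_lift_eq_closure, hΓ], fun l => closure (B l),
    fun l => isClosed_closure, hdisj, ?_, ?_⟩
  · rintro ⟨i, b⟩ p hp
    have key : ∀ p, p ∉ closure (B (i, false)) → γ i • p ∈ closure (B (i, true)) := fun p hp =>
      subset_closure ((hmap i) ▸ mem_image_of_mem _ hp)
    cases b
    · have h1 : (FreeGroup.lift γ) (FreeGroup.mk [(i, false)]) = (γ i)⁻¹ := by simp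
      rw [h1]
      by_contra h2
      have := key _ h2
      rw [smul_inv_smul] at this
      exact hp this
    · have h1 : (FreeGroup.lift γ) (FreeGroup.mk [(i, true)]) = γ i := by simp
      rw [h1]
      exact key p hp
  · obtain ⟨r, hr⟩ := hconn.nonempty
    exact ⟨r, by simpa using hr⟩

/-- Compares the marking `ρ` with the one by the ping-pong generators: only the image of `ρ` is
assumed to be Schottky, so the two bases may differ. -/
lemma MonoidHom.exists_mulEquiv_of_range_eq {F F' G : Type*} [Group F] [Group F'] [Group G]
    {ρ : F →* G} {σ : F' →* G} (hρ : Function.Injective ρ) (hσ : Function.Injective σ)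
    (h : σ.range = ρ.range) : ∃ e : F ≃* F', ∀ u, σ (e u) = ρ u := by
  refine ⟨(ρ.ofInjective hρ).trans ((MulEquiv.subgroupCongr h.symm).trans
    (σ.ofInjective hσ).symm), fun u => ?_⟩
  have := σ.apply_ofInjective_symm hσ (MulEquiv.subgroupCongr h.symm (ρ.ofInjective hρ u))
  exact this

/-! ### Limits and ends for an arbitrary marking of a Schottky group -/

section

variable {ρ : FreeGroup (Fin g) →* PGL(2, ℂ)}

lemma IsSchottkyRep.hasWanderingPoint (hρ : IsSchottkyRep ρ) : HasWanderingPoint ρ := by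
  obtain ⟨σ, hσ, C, hC⟩ := hρ.isSchottky.exists_pingPong
  obtain ⟨e, he⟩ := MonoidHom.exists_mulEquiv_of_range_eq hρ.injective hC.injective hσ
  obtain ⟨r, U, hU, hr⟩ := hC.hasWanderingPoint
  refine ⟨r, U, hU, fun u hu => ?_⟩
  rw [← he] at hu
  simpa using hr _ hu

/-- Ultrafilters on a Schottky group have the same limit iff they have the same end. -/
lemma IsSchottkyRep.eq_iff_sameEnd (hρ : IsSchottkyRep ρ) {x₀ : RSphere}
    (hx₀ : x₀ ∉ limitSet ρ.range) {𝒰 𝒱 : Ultrafilter (FreeGroup (Fin g))}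
    (h𝒰 : (𝒰 : Filter (FreeGroup (Fin g))) ≤ cofinite)
    (h𝒱 : (𝒱 : Filter (FreeGroup (Fin g))) ≤ cofinite) {p q : RSphere}
    (hp : Tendsto (fun u => ρ u • x₀) 𝒰 (𝓝 p)) (hq : Tendsto (fun u => ρ u • x₀) 𝒱 (𝓝 q)) :
    p = q ↔ SameEnd 𝒰 𝒱 := by
  obtain ⟨σ, hσ, C, hC⟩ := hρ.isSchottky.exists_pingPong
  obtain ⟨e, he⟩ := MonoidHom.exists_mulEquiv_of_range_eq hρ.injective hC.injective hσ
  -- By north-south dynamics every base point other than the repelling one has the same limit; `x₀`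
  -- can be replaced by a point outside the ping-pong tables.
  have key : ∀ {𝒲 : Ultrafilter (FreeGroup (Fin g))} {s : RSphere},
      (𝒲 : Filter (FreeGroup (Fin g))) ≤ cofinite → Tendsto (fun u => ρ u • x₀) 𝒲 (𝓝 s) →
      ∃ r, (∀ l, r ∉ C l) ∧ Tendsto (fun u => σ u • r) (𝒲.map e) (𝓝 s) := by
    intro 𝒲 s h𝒲 hs
    obtain ⟨b, c, h⟩ := hρ.hasWanderingPoint.exists_northSouth 𝒲 h𝒲 (f := id)
      Function.injective_id
    have hsc : s = c := tendsto_nhds_unique hs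
      (h.tendsto_apply fun hb => hx₀ (hb ▸ h.mem_limitSet' hρ.injective h𝒲))
    obtain ⟨r, hr, hrb⟩ := hC.exists_notMem_ne b
    refine ⟨r, hr, ?_⟩
    rw [Ultrafilter.coe_map, tendsto_map'_iff, hsc]
    simpa only [Function.comp_def, he, id] using h.tendsto_apply hrb
  obtain ⟨r, hr, hlim⟩ := key h𝒰 hp
  obtain ⟨r', hr', hlim'⟩ := key h𝒱 hq
  have he𝒰 : ((𝒰.map e : Ultrafilter _) : Filter (FreeGroup (Fin g))) ≤ cofinite :=
    map_le_cofinite e.injective h𝒰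
  have he𝒱 : ((𝒱.map e : Ultrafilter _) : Filter (FreeGroup (Fin g))) ≤ cofinite :=
    map_le_cofinite e.injective h𝒱
  obtain ⟨c, hc⟩ := hC.exists_end_limit he𝒰
  -- Change of basis respects ends, so it suffices to compare them for the ping-pong generators.
  rw [← sameEnd_map_iff h𝒰 e]
  constructor
  · rintro rfl
    exact hC.sameEnd_of_tendsto hr hr' he𝒰 he𝒱 hlim hlim'
  · intro h
    rw [hc r _ p hr (fun _ => Iff.rfl) hlim, hc r' _ q hr' h hlim']

end

end PingPong

/-! ## The sets of ends of words -/

section Ends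

open FreeGroup

variable {g : ℕ}

lemma exists_letter_isReduced [NeZero g] (w : FreeGroup (Fin g)) :
    ∃ l : Fin g × Bool, IsReduced (w.toWord ++ [l]) := by
  rcases List.eq_nil_or_concat' w.toWord with h | ⟨v, a, h⟩
  · exact ⟨(0, true), by rw [h]; exact IsReduced.singleton⟩
  -- Repeating the last letter never causes a cancellation.
  · refine ⟨a, ?_⟩
    have hred : IsReduced w.toWord := isReduced_toWord
    rw [h] at hred ⊢
    refine IsReduced.append_overlap hred ?_ (List.cons_ne_nil a [])
    rw [List.singleton_append, isReduced_cons_cons]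
    exact ⟨fun _ => rfl, IsReduced.singleton⟩

lemma infinite_cylinder [NeZero g] (w : FreeGroup (Fin g)) : (cylinder w).Infinite := by
  have h : ∀ n, ∃ u ∈ cylinder w, n ≤ u.norm := by
    intro n
    induction n with
    | zero => exact ⟨w, mem_cylinder_self w, Nat.zero_le _⟩
    | succ n ih =>
      obtain ⟨u, hu, hn⟩ := ih
      obtain ⟨l, hl⟩ := exists_letter_isReduced u
      have hw := toWord_mk_of_isReduced hl
      refine ⟨FreeGroup.mk (u.toWord ++ [l]), ?_, ?_⟩
      · refine cylinder_subset_cylinder hu ?_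
        rw [FreeGroup.cylinder, mem_ofPred_eq, hw]
        exact List.prefix_append _ _
      · rw [FreeGroup.norm, hw, List.length_append]
        exact Nat.succ_le_succ hn
  intro hfin
  obtain ⟨N, hN⟩ := (hfin.image FreeGroup.norm).bddAbove
  obtain ⟨u, hu, hn⟩ := h (N + 1)
  have := hN (mem_image_of_mem _ hu)
  omega

namespace IsSchottkyRep

variable {ρ : FreeGroup (Fin g) →* PGL(2, ℂ)} {x₀ : RSphere}

/-- `limUnder` is meaningful only once a limit is known to exist. All ultrafilters finer than the
boundary filter have the same end, hence the same limit. -/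
lemma tendsto_floydMap (hρ : IsSchottkyRep ρ) (hx₀ : x₀ ∉ limitSet ρ.range) (v : FloydBoundary g) :
    Tendsto (fun u => ρ u • x₀) (boundaryFilter v) (𝓝 (floydMap ρ x₀ v)) := by
  have hle := boundaryFilter_le_cofinite v
  obtain ⟨c, -, hc⟩ := hρ.hasWanderingPoint.exists_limit hρ.injective hx₀
    (Ultrafilter.of (boundaryFilter v)) ((Ultrafilter.of_le _).trans hle)
  have h : Tendsto (fun u => ρ u • x₀) (boundaryFilter v) (𝓝 c) := by
    rw [tendsto_iff_ultrafilter]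
    intro 𝒰 h𝒰
    obtain ⟨d, -, hd⟩ := hρ.hasWanderingPoint.exists_limit hρ.injective hx₀ 𝒰 (h𝒰.trans hle)
    rwa [(hρ.eq_iff_sameEnd hx₀ ((Ultrafilter.of_le _).trans hle) (h𝒰.trans hle) hc hd).2
      (sameEnd_of_le_boundaryFilter (Ultrafilter.of_le _) h𝒰)]
  have h2 : floydMap ρ x₀ v = c := h.limUnder_eq
  rwa [h2]

/-- Membership in a set of ends can be tested on any ultrafilter defining `p`, because equal limits
have equal ends. All properties of the sets of ends are read off from cylinders in this way. -/
lemma mem_ends_iff_mem (hρ : IsSchottkyRep ρ) (hx₀ : x₀ ∉ limitSet ρ.range)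
    {𝒰 : Ultrafilter (FreeGroup (Fin g))} (h𝒰 : (𝒰 : Filter (FreeGroup (Fin g))) ≤ cofinite)
    {p : limitSet ρ.range} (hp : Tendsto (fun u => ρ u • x₀) 𝒰 (𝓝 p.1))
    (w : FreeGroup (Fin g)) : p ∈ ends ρ x₀ w ↔ cylinder w ∈ 𝒰 := by
  constructor
  · rintro ⟨v, hw, hv⟩
    have hle := (Ultrafilter.of_le (boundaryFilter v)).trans (boundaryFilter_le_cofinite v)
    have h1 := (hρ.tendsto_floydMap hx₀ v).mono_left (Ultrafilter.of_le _)
    rw [((hρ.eq_iff_sameEnd hx₀ h𝒰 hle hp h1).1 hv.symm) w]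
    exact Ultrafilter.of_le _ (isInitialWord_iff.1 hw)
  · intro hw
    obtain ⟨v, hv⟩ := exists_boundary_of_ultrafilter h𝒰
    exact ⟨v, (mem_ultrafilter_iff_isInitialWord hv w).1 hw,
      tendsto_nhds_unique ((hρ.tendsto_floydMap hx₀ v).mono_left hv) hp⟩

lemma exists_ultrafilter (hρ : IsSchottkyRep ρ) (hx₀ : x₀ ∉ limitSet ρ.range)
    (p : limitSet ρ.range) : ∃ 𝒰 : Ultrafilter (FreeGroup (Fin g)),
      (𝒰 : Filter (FreeGroup (Fin g))) ≤ cofinite ∧ Tendsto (fun u => ρ u • x₀) 𝒰 (𝓝 p.1) :=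
  hρ.hasWanderingPoint.exists_ultrafilter hρ.injective hx₀ p.2

/-- The definition of `ends` provides some preimage of `p` under Floyd's map; by injectivity the
given `v` serves as well. This makes membership independent of `ρ`. -/
lemma mem_ends_iff_isInitialWord (hρ : IsSchottkyRep ρ) (hx₀ : x₀ ∉ limitSet ρ.range)
    {v : FloydBoundary g} {p : limitSet ρ.range} (h : floydMap ρ x₀ v = p)
    (w : FreeGroup (Fin g)) : p ∈ ends ρ x₀ w ↔ IsInitialWord w v := by
  have hle := (Ultrafilter.of_le (boundaryFilter v)).trans (boundaryFilter_le_cofinite v)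
  have h1 := (hρ.tendsto_floydMap hx₀ v).mono_left (Ultrafilter.of_le _)
  rw [h] at h1
  rw [hρ.mem_ends_iff_mem hx₀ hle h1,
    mem_ultrafilter_iff_isInitialWord (Ultrafilter.of_le (boundaryFilter v))]

/-- These are the cluster points of the orbit along a filter. Applied to a cylinder and to its
complement, it shows that sets of ends are clopen. -/
lemma isClosed_setOf_exists (ρ : FreeGroup (Fin g) →* PGL(2, ℂ)) (x₀ : RSphere) (E : Set (FreeGroup (Fin g))) :
    IsClosed {p : limitSet ρ.range | ∃ 𝒰 : Ultrafilter (FreeGroup (Fin g)),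
      (𝒰 : Filter (FreeGroup (Fin g))) ≤ cofinite ∧ E ∈ 𝒰 ∧
        Tendsto (fun u => ρ u • x₀) 𝒰 (𝓝 p.1)} := by
  have h : IsClosed {p : RSphere | MapClusterPt p (cofinite ⊓ 𝓟 E) fun u => ρ u • x₀} :=
    isClosed_setOfPred_clusterPt
  convert h.preimage continuous_subtype_val using 1
  ext p
  simp only [mem_ofPred_eq, mem_preimage, mapClusterPt_iff_ultrafilter, le_inf_iff,
    le_principal_iff, and_assoc]
  rfl

lemma isClopen_ends (hρ : IsSchottkyRep ρ) (hx₀ : x₀ ∉ limitSet ρ.range)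
    (w : FreeGroup (Fin g)) : IsClopen (ends ρ x₀ w) := by
  constructor
  · convert isClosed_setOf_exists ρ x₀ (cylinder w) using 1
    ext p
    constructor
    · intro hp
      obtain ⟨𝒰, h𝒰, hlim⟩ := hρ.exists_ultrafilter hx₀ p
      exact ⟨𝒰, h𝒰, (hρ.mem_ends_iff_mem hx₀ h𝒰 hlim w).1 hp, hlim⟩
    · rintro ⟨𝒰, h𝒰, hw, hlim⟩
      exact (hρ.mem_ends_iff_mem hx₀ h𝒰 hlim w).2 hw
  · rw [← isClosed_compl_iff]
    convert isClosed_setOf_exists ρ x₀ (cylinder w)ᶜ using 1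
    ext p
    constructor
    · intro hp
      obtain ⟨𝒰, h𝒰, hlim⟩ := hρ.exists_ultrafilter hx₀ p
      exact ⟨𝒰, h𝒰, Ultrafilter.compl_mem_iff_notMem.2
        (mt (hρ.mem_ends_iff_mem hx₀ h𝒰 hlim w).2 hp), hlim⟩
    · rintro ⟨𝒰, h𝒰, hw, hlim⟩ hp
      exact Ultrafilter.compl_mem_iff_notMem.1 hw ((hρ.mem_ends_iff_mem hx₀ h𝒰 hlim w).1 hp)

lemma ends_one (hρ : IsSchottkyRep ρ) (hx₀ : x₀ ∉ limitSet ρ.range) : ends ρ x₀ 1 = univ := by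
  ext p
  obtain ⟨𝒰, h𝒰, hlim⟩ := hρ.exists_ultrafilter hx₀ p
  rw [hρ.mem_ends_iff_mem hx₀ h𝒰 hlim, cylinder_one]
  exact iff_of_true univ_mem trivial

lemma ends_nonempty [NeZero g] (hρ : IsSchottkyRep ρ) (hx₀ : x₀ ∉ limitSet ρ.range)
    (w : FreeGroup (Fin g)) : (ends ρ x₀ w).Nonempty := by
  have : NeBot (cofinite ⊓ 𝓟 (cylinder w)) := cofinite_inf_principal_neBot_iff.2
    (infinite_cylinder w)
  have hle : ((Ultrafilter.of (cofinite ⊓ 𝓟 (cylinder w)) : Ultrafilter _) :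
      Filter (FreeGroup (Fin g))) ≤ cofinite ⊓ 𝓟 (cylinder w) := Ultrafilter.of_le _
  obtain ⟨p, hp, hlim⟩ := hρ.hasWanderingPoint.exists_limit hρ.injective hx₀ _
    (hle.trans inf_le_left)
  exact ⟨⟨p, hp⟩, (hρ.mem_ends_iff_mem hx₀ (hle.trans inf_le_left) hlim w).2
    (le_principal_iff.1 (hle.trans inf_le_right))⟩

/-- Initial segments of one word are comparable, so sets of ends are nested or disjoint like
cylinders. -/
lemma mem_ends_iff_mem_cylinder (hρ : IsSchottkyRep ρ) (hx₀ : x₀ ∉ limitSet ρ.range)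
    {w z : FreeGroup (Fin g)} (hn : w.norm ≤ z.norm) {p : limitSet ρ.range}
    (hp : p ∈ ends ρ x₀ z) : p ∈ ends ρ x₀ w ↔ z ∈ cylinder w := by
  obtain ⟨𝒰, h𝒰, hlim⟩ := hρ.exists_ultrafilter hx₀ p
  rw [hρ.mem_ends_iff_mem hx₀ h𝒰 hlim] at hp ⊢
  constructor
  · intro hw
    obtain ⟨u, hu, hu'⟩ := 𝒰.nonempty_of_mem (inter_mem hw hp)
    exact mem_cylinder_of_mem_of_norm_le hu hu' hn
  · intro hz
    exact mem_of_superset hp (cylinder_subset_cylinder hz)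

lemma mem_ends_of_mem_cylinder (hρ : IsSchottkyRep ρ) (hx₀ : x₀ ∉ limitSet ρ.range)
    {w z : FreeGroup (Fin g)} (hz : z ∈ cylinder w) {p : limitSet ρ.range}
    (hp : p ∈ ends ρ x₀ z) : p ∈ ends ρ x₀ w :=
  (hρ.mem_ends_iff_mem_cylinder hx₀ (norm_le_of_mem_cylinder hz) hp).2 hz

/-- The sets of ends of the words of a given length form a partition of the limit set. -/
lemma exists_norm_mem_ends (hρ : IsSchottkyRep ρ) (hx₀ : x₀ ∉ limitSet ρ.range)
    (n : ℕ) (p : limitSet ρ.range) : ∃ w : FreeGroup (Fin g), w.norm = n ∧ p ∈ ends ρ x₀ w := by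
  obtain ⟨𝒰, h𝒰, hlim⟩ := hρ.exists_ultrafilter hx₀ p
  obtain ⟨w, hn, hw⟩ := exists_cylinder_mem h𝒰 n
  exact ⟨w, hn, (hρ.mem_ends_iff_mem hx₀ h𝒰 hlim w).2 hw⟩

lemma eq_of_mem_ends (hρ : IsSchottkyRep ρ) (hx₀ : x₀ ∉ limitSet ρ.range)
    {w z : FreeGroup (Fin g)} (hn : w.norm = z.norm) {p : limitSet ρ.range}
    (hw : p ∈ ends ρ x₀ w) (hz : p ∈ ends ρ x₀ z) : w = z :=
  eq_of_mem_cylinder_of_norm_eq ((hρ.mem_ends_iff_mem_cylinder hx₀ hn.le hz).1 hw)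
    (mem_cylinder_self z) hn

/-- Left multiplication by `m` does not cancel against `l`, so it carries words beginning with `l`
to words beginning with `m`. It serves to compare the measures of the ends of different letters. -/
lemma smul_mem_ends (hρ : IsSchottkyRep ρ) (hx₀ : x₀ ∉ limitSet ρ.range)
    {l m : Fin g × Bool} (hml : IsReduced [m, l]) {p : limitSet ρ.range}
    (hp : p ∈ ends ρ x₀ (FreeGroup.mk [l])) :
    ∃ q ∈ ends ρ x₀ (FreeGroup.mk [m]), q.1 = ρ (FreeGroup.mk [m]) • p.1 := by
  obtain ⟨𝒰, h𝒰, hlim⟩ := hρ.exists_ultrafilter hx₀ p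
  rw [hρ.mem_ends_iff_mem hx₀ h𝒰 hlim] at hp
  have h𝒱 : ((𝒰.map (FreeGroup.mk [m] * ·) : Ultrafilter _) : Filter (FreeGroup (Fin g))) ≤
    cofinite := map_le_cofinite (mul_right_injective _) h𝒰
  have hlim' : Tendsto (fun u => ρ u • x₀) (𝒰.map (FreeGroup.mk [m] * ·))
      (𝓝 (ρ (FreeGroup.mk [m]) • p.1)) := by
    rw [Ultrafilter.coe_map, tendsto_map'_iff]
    refine (hlim.const_smul (ρ (FreeGroup.mk [m]))).congr fun v => ?_
    rw [Function.comp_apply, _root_.map_mul, mul_smul]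
  have hmem : ρ (FreeGroup.mk [m]) • p.1 ∈ limitSet ρ.range :=
    mem_limitSet_of_tendsto hρ.injective h𝒱 hlim'
  refine ⟨⟨_, hmem⟩, (hρ.mem_ends_iff_mem hx₀ h𝒱 hlim' _).2 ?_, rfl⟩
  rw [Ultrafilter.mem_map]
  filter_upwards [hp] with u hu
  rw [FreeGroup.cylinder, mem_ofPred_eq, toWord_letter] at hu
  obtain ⟨t, ht⟩ := hu
  have hu' : IsReduced ([l] ++ t) := ht ▸ isReduced_toWord
  have hred : IsReduced ([m] ++ [l] ++ t) :=
    IsReduced.append_overlap hml hu' (List.cons_ne_nil l [])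
  have h1 : FreeGroup.mk [m] * u = FreeGroup.mk ([m] ++ [l] ++ t) := by
    rw [List.append_assoc, ht, ← FreeGroup.mul_mk, FreeGroup.mk_toWord]
  rw [mem_preimage, h1, FreeGroup.cylinder, mem_ofPred_eq, toWord_mk_of_isReduced hred, toWord_letter,
    List.append_assoc]
  exact List.prefix_append _ _

/-- The characteristic function of the set of ends of a word. -/
def charFun (hρ : IsSchottkyRep ρ) (hx₀ : x₀ ∉ limitSet ρ.range) (w : FreeGroup (Fin g)) :
    C(limitSet ρ.range, ℂ) where
  toFun := (ends ρ x₀ w).indicator 1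
  continuous_toFun := (hρ.isClopen_ends hx₀ w).continuous_indicator continuous_one

lemma charFun_apply (hρ : IsSchottkyRep ρ) (hx₀ : x₀ ∉ limitSet ρ.range) (w : FreeGroup (Fin g))
    (p : limitSet ρ.range) : hρ.charFun hx₀ w p = (ends ρ x₀ w).indicator 1 p := rfl

lemma isCharFun_iff (hρ : IsSchottkyRep ρ) (hx₀ : x₀ ∉ limitSet ρ.range) (w : FreeGroup (Fin g))
    (f : C(limitSet ρ.range, ℂ)) : IsCharFun ρ x₀ w f ↔ f = hρ.charFun hx₀ w :=
  ⟨fun h => by ext p; exact h p, fun h p => by rw [h, charFun_apply]⟩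

lemma charFun_one (hρ : IsSchottkyRep ρ) (hx₀ : x₀ ∉ limitSet ρ.range) :
    hρ.charFun hx₀ 1 = 1 := by
  ext p
  rw [charFun_apply, hρ.ends_one hx₀]
  simp

lemma locConst_eq (hρ : IsSchottkyRep ρ) (hx₀ : x₀ ∉ limitSet ρ.range) (n : ℕ) :
    locConst ρ x₀ n = Submodule.span ℂ (hρ.charFun hx₀ '' {w | w.norm ≤ n}) := by
  unfold locConst
  congr 1
  ext f
  simp only [isCharFun_iff hρ hx₀, mem_ofPred_eq, mem_image]
  exact exists_congr fun w => and_congr_right fun _ => eq_comm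

lemma charFun_mem_locConstAll (hρ : IsSchottkyRep ρ) (hx₀ : x₀ ∉ limitSet ρ.range)
    (w : FreeGroup (Fin g)) : hρ.charFun hx₀ w ∈ locConstAll ρ x₀ :=
  Submodule.subset_span ⟨w, (hρ.isCharFun_iff hx₀ w _).2 rfl⟩

lemma charFun_mem_locConst (hρ : IsSchottkyRep ρ) (hx₀ : x₀ ∉ limitSet ρ.range)
    {w : FreeGroup (Fin g)} {n : ℕ} (hw : w.norm ≤ n) : hρ.charFun hx₀ w ∈ locConst ρ x₀ n := by
  rw [hρ.locConst_eq hx₀]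
  exact Submodule.subset_span ⟨w, hw, rfl⟩

lemma monotone_locConst (ρ : FreeGroup (Fin g) →* PGL(2, ℂ)) (x₀ : RSphere) :
    Monotone (locConst ρ x₀) := fun _ _ h =>
  Submodule.span_mono fun _ ⟨w, hw, hf⟩ => ⟨w, hw.trans h, hf⟩

lemma locConst_zero (hρ : IsSchottkyRep ρ) (hx₀ : x₀ ∉ limitSet ρ.range) :
    locConst ρ x₀ 0 = ℂ ∙ 1 := by
  rw [hρ.locConst_eq hx₀, ← hρ.charFun_one hx₀, ← image_singleton]
  congr 2
  ext w
  simp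

lemma nonempty_limitSet [NeZero g] (hρ : IsSchottkyRep ρ) (hx₀ : x₀ ∉ limitSet ρ.range) :
    Nonempty (limitSet ρ.range) := (hρ.ends_nonempty hx₀ 1).to_type

lemma finrank_locConst_zero [NeZero g] (hρ : IsSchottkyRep ρ) (hx₀ : x₀ ∉ limitSet ρ.range) :
    Module.finrank ℂ (locConst ρ x₀ 0) = 1 := by
  have := hρ.nonempty_limitSet hx₀
  rw [hρ.locConst_zero hx₀]
  exact finrank_span_singleton one_ne_zero

lemma linearIndependent_charFun [NeZero g] (hρ : IsSchottkyRep ρ) (hx₀ : x₀ ∉ limitSet ρ.range) :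
    LinearIndependent ℂ fun l : Fin g × Bool => hρ.charFun hx₀ (FreeGroup.mk [l]) := by
  rw [Fintype.linearIndependent_iff]
  intro c hc l
  obtain ⟨p, hp⟩ := hρ.ends_nonempty hx₀ (FreeGroup.mk [l])
  have h1 := congrArg (fun f : C(limitSet ρ.range, ℂ) => f p) hc
  simp only [ContinuousMap.sum_apply, ContinuousMap.smul_apply, charFun_apply,
    ContinuousMap.zero_apply] at h1
  rw [Finset.sum_eq_single l] at h1
  · simpa [hp] using h1
  · intro m _ hm
    rw [indicator_of_notMem, smul_zero]
    intro hpm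
    have := hρ.eq_of_mem_ends hx₀ (by simp [FreeGroup.norm]) hp hpm
    have := congrArg FreeGroup.toWord this
    rw [toWord_letter, toWord_letter] at this
    exact hm (List.singleton_inj.1 this).symm
  · simp

lemma sum_charFun (hρ : IsSchottkyRep ρ) (hx₀ : x₀ ∉ limitSet ρ.range) :
    ∑ l : Fin g × Bool, hρ.charFun hx₀ (FreeGroup.mk [l]) = 1 := by
  ext p
  obtain ⟨w, hn, hw⟩ := hρ.exists_norm_mem_ends hx₀ 1 p
  obtain ⟨l, hl⟩ := List.length_eq_one_iff.1 hn
  have hwl : w = FreeGroup.mk [l] := by rw [← hl, FreeGroup.mk_toWord]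
  rw [ContinuousMap.sum_apply, Finset.sum_eq_single l]
  · rw [charFun_apply, ← hwl, indicator_of_mem hw]
    rfl
  · intro m _ hm
    rw [charFun_apply, indicator_of_notMem]
    intro hpm
    have := congrArg FreeGroup.toWord
      (hρ.eq_of_mem_ends hx₀ (by rw [hwl]; simp [FreeGroup.norm]) hw hpm)
    rw [hl, toWord_letter] at this
    exact hm (List.singleton_inj.1 this).symm
  · simp

/-- The empty word contributes nothing new, the constant `1` being the sum over all letters; hence
the dimension `2 * g` and not `2 * g + 1`. -/
lemma locConst_one (hρ : IsSchottkyRep ρ) (hx₀ : x₀ ∉ limitSet ρ.range) :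
    locConst ρ x₀ 1 =
      Submodule.span ℂ (range fun l : Fin g × Bool => hρ.charFun hx₀ (FreeGroup.mk [l])) := by
  rw [hρ.locConst_eq hx₀]
  refine le_antisymm (Submodule.span_le.2 ?_) (Submodule.span_mono ?_)
  · rintro _ ⟨w, hw, rfl⟩
    rcases Nat.le_one_iff_eq_zero_or_eq_one.1 hw with h | h
    · rw [FreeGroup.norm_eq_zero.1 h, hρ.charFun_one hx₀, ← hρ.sum_charFun hx₀]
      exact Submodule.sum_mem _ fun l _ => Submodule.subset_span ⟨l, rfl⟩
    · obtain ⟨l, hl⟩ := List.length_eq_one_iff.1 h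
      exact Submodule.subset_span ⟨l, by simp only [← hl, FreeGroup.mk_toWord]⟩
  · rintro _ ⟨l, rfl⟩
    exact ⟨_, by simp [FreeGroup.norm], rfl⟩

lemma finrank_locConst_one [NeZero g] (hρ : IsSchottkyRep ρ) (hx₀ : x₀ ∉ limitSet ρ.range) :
    Module.finrank ℂ (locConst ρ x₀ 1) = 2 * g := by
  rw [hρ.locConst_one hx₀, finrank_span_eq_card (hρ.linearIndependent_charFun hx₀)]
  simp [mul_comm]

/-- Functions in `A n` cannot separate ends with a common initial segment of length `n`, whereas
those in `A (n + 1)` can. Such ends are found by extending the `n`-th power of one generator by that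
generator or by a second one. -/
lemma strictMono_finrank_locConst (hg : 2 ≤ g) (hρ : IsSchottkyRep ρ)
    (hx₀ : x₀ ∉ limitSet ρ.range) :
    StrictMono fun n => Module.finrank ℂ (locConst ρ x₀ n) := by
  have : NeZero g := ⟨by omega⟩
  refine strictMono_nat_of_lt_succ fun n => ?_
  refine Submodule.finrank_lt_finrank_of_lt (lt_of_le_of_ne
    (monotone_locConst ρ x₀ n.le_succ) fun heq => ?_)
  let i : Fin g := ⟨0, by omega⟩
  let j : Fin g := ⟨1, by omega⟩
  have hij : i ≠ j := by simp [i, j]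
  set z : FreeGroup (Fin g) := FreeGroup.of i ^ n with hz
  have hzw : z.toWord = List.replicate n (i, true) := toWord_of_pow i n
  have hzn : z.norm = n := by rw [FreeGroup.norm, hzw, List.length_replicate]
  have hred : ∀ k : Fin g, IsReduced (z.toWord ++ [(k, true)]) := by
    intro k
    rw [hzw, FreeGroup.IsReduced, List.isChain_append]
    refine ⟨List.isChain_replicate_of_rel _ fun _ => rfl, List.isChain_singleton _, ?_⟩
    intro x hx y hy _
    rw [List.eq_of_mem_replicate (List.mem_of_mem_getLast? hx)]
    simp only [List.head?_cons, Option.mem_def, Option.some.injEq] at hy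
    rw [← hy]
  have hext : ∀ k : Fin g, (FreeGroup.mk (z.toWord ++ [(k, true)])).norm = n + 1 ∧
      FreeGroup.mk (z.toWord ++ [(k, true)]) ∈ cylinder z := by
    intro k
    have := toWord_mk_of_isReduced (hred k)
    constructor
    · rw [FreeGroup.norm, this, List.length_append]
      simp only [FreeGroup.norm] at hzn
      rw [hzn]; rfl
    · rw [FreeGroup.cylinder, mem_ofPred_eq, this]
      exact List.prefix_append _ _
  obtain ⟨p, hp⟩ := hρ.ends_nonempty hx₀ (FreeGroup.mk (z.toWord ++ [(i, true)]))
  obtain ⟨q, hq⟩ := hρ.ends_nonempty hx₀ (FreeGroup.mk (z.toWord ++ [(j, true)]))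
  have hconst : ∀ f ∈ locConst ρ x₀ n, f p = f q := by
    intro f hf
    rw [hρ.locConst_eq hx₀] at hf
    induction hf using Submodule.span_induction with
    | mem f hf =>
      obtain ⟨w, hw, rfl⟩ := hf
      have h1 := hρ.mem_ends_iff_mem_cylinder hx₀ (hw.trans hzn.ge)
        (hρ.mem_ends_of_mem_cylinder hx₀ (hext i).2 hp)
      have h2 := hρ.mem_ends_iff_mem_cylinder hx₀ (hw.trans hzn.ge)
        (hρ.mem_ends_of_mem_cylinder hx₀ (hext j).2 hq)
      rw [charFun_apply, charFun_apply]
      by_cases h : z ∈ cylinder w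
      · rw [indicator_of_mem (h1.2 h), indicator_of_mem (h2.2 h)]; rfl
      · rw [indicator_of_notMem (mt h1.1 h), indicator_of_notMem (mt h2.1 h)]
    | zero => rfl
    | add f f' _ _ h h' => simp [h, h']
    | smul c f _ h => simp [h]
  have hmem : hρ.charFun hx₀ (FreeGroup.mk (z.toWord ++ [(i, true)])) ∈ locConst ρ x₀ n := by
    rw [heq]
    exact hρ.charFun_mem_locConst hx₀ (hext i).1.le
  have h := hconst _ hmem
  rw [charFun_apply, charFun_apply, indicator_of_mem hp, indicator_of_notMem] at h
  · exact one_ne_zero h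
  · intro hq'
    have := hρ.eq_of_mem_ends hx₀ ((hext i).1.trans (hext j).1.symm) hq' hq
    have := congrArg FreeGroup.toWord this
    rw [toWord_mk_of_isReduced (hred i), toWord_mk_of_isReduced (hred j)] at this
    simp [hij] at this

end IsSchottkyRep

end Ends

/-! ## Traces -/

section Trace

variable {H : Type} [NormedAddCommGroup H] [InnerProductSpace ℂ H]

lemma hasSum_norm_inner_sq {ι : Type} (b : HilbertBasis ι ℂ H) (x : H) :
    HasSum (fun i => ‖inner ℂ (b i) x‖ ^ 2) (‖x‖ ^ 2) := by
  have h := b.hasSum_inner_mul_inner x x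
  rw [inner_self_eq_norm_sq_to_K] at h
  have h2 : ∀ i, inner ℂ x (b i) * inner ℂ (b i) x = ((‖inner ℂ (b i) x‖ ^ 2 : ℝ) : ℂ) := by
    intro i
    rw [← inner_conj_symm, ← Complex.normSq_eq_conj_mul_self, Complex.normSq_eq_norm_sq]
  simp only [h2] at h
  have h3 := Complex.reCLM.hasSum h
  simpa [← Complex.ofReal_pow] using h3

/-- Completeness supplies an orthonormal basis, without which `HasTrace` would hold for every value.
-/
lemma HasTrace.opTrace_eq [CompleteSpace H] {T : H → H} {t : ℂ} (h : HasTrace T t) :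
    opTrace T = t := by
  have hex : ∃ t, HasTrace T t := ⟨t, h⟩
  rw [opTrace, dif_pos hex]
  obtain ⟨w, b, -⟩ := exists_hilbertBasis ℂ H
  exact (hex.choose_spec _ b).unique (h _ b)

/-- The trace of the compression of `T` to the subspace `V`. -/
def compressionTrace (T : H →L[ℂ] H) (V : Submodule ℂ H) [FiniteDimensional ℂ V] : ℂ :=
  ∑ j, inner ℂ (stdOrthonormalBasis ℂ V j : H) (T (stdOrthonormalBasis ℂ V j))

variable (T : H →L[ℂ] H) (V : Submodule ℂ H) [FiniteDimensional ℂ V]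

lemma norm_stdOrthonormalBasis (j) : ‖(stdOrthonormalBasis ℂ V j : H)‖ = 1 := by
  rw [Submodule.norm_coe]
  exact (stdOrthonormalBasis ℂ V).norm_eq_one j

lemma norm_compressionTrace_le :
    ‖compressionTrace T V‖ ≤ Module.finrank ℂ V * ‖T‖ := by
  refine (norm_sum_le _ _).trans ?_
  refine (Finset.sum_le_card_nsmul _ _ ‖T‖ fun j _ => ?_).trans (by simp)
  refine (norm_inner_le_norm _ _).trans ?_
  rw [norm_stdOrthonormalBasis, one_mul]
  simpa [norm_stdOrthonormalBasis] using T.le_opNorm (stdOrthonormalBasis ℂ V j : H)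

lemma compressionTrace_id :
    compressionTrace (ContinuousLinearMap.id ℂ H) V = Module.finrank ℂ V := by
  simp [compressionTrace, inner_self_eq_norm_sq_to_K, norm_stdOrthonormalBasis]

/-- The chosen basis of the line need not consist of `x`, but its elements are multiples of `x`,
with squared coefficients summing to `1`. -/
lemma compressionTrace_span_singleton {x : H} (hx : ‖x‖ = 1) (hV : V = ℂ ∙ x) :
    compressionTrace T V = inner ℂ x (T x) := by
  have hxV : x ∈ V := hV ▸ Submodule.mem_span_singleton_self x
  have h : ∀ j, (stdOrthonormalBasis ℂ V j : H) =
      inner ℂ x (stdOrthonormalBasis ℂ V j : H) • x := by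
    intro j
    have hj : (stdOrthonormalBasis ℂ V j : H) ∈ ℂ ∙ x := hV ▸ (stdOrthonormalBasis ℂ V j).2
    obtain ⟨c, hc⟩ := Submodule.mem_span_singleton.1 hj
    rw [← hc, inner_smul_right, inner_self_eq_norm_sq_to_K, hx]
    simp
  have hsum := (stdOrthonormalBasis ℂ V).sum_sq_norm_inner_right ⟨x, hxV⟩
  rw [Submodule.coe_norm, hx] at hsum
  calc compressionTrace T V
      = ∑ j, ((‖inner ℂ (stdOrthonormalBasis ℂ V j) (⟨x, hxV⟩ : V)‖ ^ 2 : ℝ) : ℂ) *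
          inner ℂ x (T x) := by
        refine Finset.sum_congr rfl fun j _ => ?_
        rw [h j, map_smul, inner_smul_left, inner_smul_right, ← mul_assoc,
          ← Complex.normSq_eq_conj_mul_self, Complex.normSq_eq_norm_sq, norm_inner_symm]
        rfl
    _ = inner ℂ x (T x) := by
        rw [← Finset.sum_mul, ← Complex.ofReal_sum, hsum]
        simp

lemma inner_starProjection_eq_sum (ξ η : H) :
    inner ℂ η (T (V.starProjection ξ)) = ∑ j, inner ℂ (stdOrthonormalBasis ℂ V j : H) ξ *
      inner ℂ η (T (stdOrthonormalBasis ℂ V j)) := by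
  rw [(stdOrthonormalBasis ℂ V).starProjection_eq_sum_rankOne]
  simp

lemma hasSum_inner_starProjection {ι : Type} (b : HilbertBasis ι ℂ H) :
    HasSum (fun i => inner ℂ (b i) (T (V.starProjection (b i)))) (compressionTrace T V) := by
  simp only [inner_starProjection_eq_sum]
  exact hasSum_sum fun j _ => b.hasSum_inner_mul_inner _ _

/-- A bound that is independent of `b` and linear in the rank, by `2xy ≤ x² + y²` and Parseval; it
justifies exchanging summations in `hasTrace_comp_tsum`. -/
lemma tsum_norm_inner_starProjection_le {ι : Type} (b : HilbertBasis ι ℂ H) :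
    ∑' i, ‖inner ℂ (b i) (T (V.starProjection (b i)))‖ ≤
      Module.finrank ℂ V * ((1 + ‖T‖ ^ 2) / 2) := by
  have h1 : ∀ j, HasSum (fun i => (‖inner ℂ (b i) (stdOrthonormalBasis ℂ V j : H)‖ ^ 2 +
      ‖inner ℂ (b i) (T (stdOrthonormalBasis ℂ V j))‖ ^ 2) / 2)
      ((1 + ‖T (stdOrthonormalBasis ℂ V j)‖ ^ 2) / 2) := by
    intro j
    have := ((hasSum_norm_inner_sq b (stdOrthonormalBasis ℂ V j : H)).add
      (hasSum_norm_inner_sq b (T (stdOrthonormalBasis ℂ V j)))).div_const 2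
    rwa [norm_stdOrthonormalBasis, one_pow] at this
  have h2 := hasSum_sum (s := Finset.univ) fun j _ => h1 j
  refine (Summable.tsum_le_tsum (fun i => ?_)
    (hasSum_inner_starProjection T V b).summable.norm h2.summable).trans ?_
  · rw [inner_starProjection_eq_sum]
    refine (norm_sum_le _ _).trans (Finset.sum_le_sum fun j _ => ?_)
    rw [norm_mul, norm_inner_symm]
    linarith [two_mul_le_add_sq ‖inner ℂ (b i) (stdOrthonormalBasis ℂ V j : H)‖
      ‖inner ℂ (b i) (T (stdOrthonormalBasis ℂ V j))‖]
  · rw [h2.tsum_eq]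
    refine (Finset.sum_le_card_nsmul _ _ ((1 + ‖T‖ ^ 2) / 2) fun j _ => ?_).trans (by simp)
    have := T.le_opNorm (stdOrthonormalBasis ℂ V j : H)
    rw [norm_stdOrthonormalBasis, mul_one] at this
    gcongr

/-- The trace of `T ∘ ∑ c n • P n` for a sequence of projections of finite rank. -/
lemma hasTrace_comp_tsum [CompleteSpace H] (W : ℕ → Submodule ℂ H) [∀ n, FiniteDimensional ℂ (W n)]
    {c : ℕ → ℂ} {d : ℕ → ℝ} (hd : ∀ n, (Module.finrank ℂ (W n) : ℝ) ≤ d n) (hd1 : ∀ n, 1 ≤ d n)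
    (hc : Summable fun n => ‖c n‖ * d n) :
    HasTrace (fun ξ => T (∑' n, c n • (W n).starProjection ξ))
      (∑' n, c n * compressionTrace T (W n)) := by
  intro ι b
  have hc1 : Summable fun n => ‖c n‖ := hc.of_nonneg_of_le (fun _ => norm_nonneg _)
    fun n => le_mul_of_one_le_right (norm_nonneg _) (hd1 n)
  have hinner : ∀ i, HasSum (fun n => c n * inner ℂ (b i) (T ((W n).starProjection (b i))))
      (inner ℂ (b i) (T (∑' n, c n • (W n).starProjection (b i)))) := by
    intro i
    have hs : Summable fun n => c n • (W n).starProjection (b i) := by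
      refine Summable.of_norm_bounded hc1 fun n => ?_
      rw [norm_smul]
      refine mul_le_of_le_one_right (norm_nonneg _) ?_
      exact ((W n).norm_starProjection_apply_le _).trans (b.orthonormal.1 i).le
    have := ((innerSL ℂ (b i)).comp T).hasSum hs.hasSum
    simpa [inner_smul_right] using this
  let f : ℕ × ι → ℂ := fun x => c x.1 * inner ℂ (b x.2) (T ((W x.1).starProjection (b x.2)))
  -- Absolute summability of the double family: summing over the basis first gives both the value
  -- and independence of the basis.
  have hf : Summable f := by
    refine Summable.of_norm ((summable_prod_of_nonneg fun _ => norm_nonneg _).2 ⟨fun n => ?_, ?_⟩)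
    · exact ((hasSum_inner_starProjection T (W n) b).mul_left (c n)).summable.norm
    · have hb : Summable fun n => ‖c n‖ * d n * ((1 + ‖T‖ ^ 2) / 2) := hc.mul_right _
      refine hb.of_nonneg_of_le (fun n => tsum_nonneg fun i => norm_nonneg _) fun n => ?_
      simp only [f, norm_mul]
      rw [tsum_mul_left, mul_assoc]
      refine mul_le_mul_of_nonneg_left ?_ (norm_nonneg _)
      refine (tsum_norm_inner_starProjection_le T (W n) b).trans ?_
      exact mul_le_mul_of_nonneg_right (hd n) (by positivity)
  have h1 := hf.hasSum.prod_fiberwise fun n =>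
    (hasSum_inner_starProjection T (W n) b).mul_left (c n)
  have h2 := ((Equiv.prodComm ι ℕ).hasSum_iff.2 hf.hasSum).prod_fiberwise hinner
  rw [h1.tsum_eq]
  exact h2

end Trace

/-! ### The zeta function as a Dirichlet series and its coefficients -/

section ZetaExpansion

variable {X : Type} [TopologicalSpace X] [CompactSpace X] [MeasurableSpace X] [BorelSpace X]
variable (μ : Measure X) [IsProbabilityMeasure μ]
lemma inner_toGNS (a b : C(X, ℂ)) :
    inner ℂ (toGNS μ a) (toGNS μ b) = ∫ x, star (a x) * b x ∂μ := by
  change inner ℂ (((measureState μ).toPreGNS a : (measureState μ).PreGNS) : GNSSpace μ)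
    (((measureState μ).toPreGNS b : (measureState μ).PreGNS) : GNSSpace μ) = _
  rw [UniformSpace.Completion.inner_coe]
  rfl

lemma gnsStarAlgHom_toGNS (a b : C(X, ℂ)) :
    (measureState μ).gnsStarAlgHom a (toGNS μ b) = toGNS μ (a * b) :=
  (measureState μ).gnsNonUnitalStarAlgHom_apply_coe

lemma norm_toGNS_one : ‖toGNS μ 1‖ = 1 := by
  have h := inner_toGNS μ 1 1
  rw [inner_self_eq_norm_sq_to_K] at h
  have h2 : ((‖toGNS μ 1‖ ^ 2 : ℝ) : ℂ) = ((1 : ℝ) : ℂ) := by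
    rw [Complex.ofReal_pow]
    refine Eq.trans h ?_
    simp
  exact (pow_eq_one_iff_of_nonneg (norm_nonneg _) two_ne_zero).1 (Complex.ofReal_inj.1 h2)

lemma ae_eq_zero_of_toGNS_eq_zero {a : C(X, ℂ)} (h : toGNS μ a = 0) : ∀ᵐ x ∂μ, a x = 0 := by
  have h1 := inner_toGNS μ a a
  rw [h, inner_zero_left] at h1
  have h2 : ∀ x, star (a x) * a x = ((‖a x‖ ^ 2 : ℝ) : ℂ) := fun x => by
    rw [← Complex.normSq_eq_norm_sq, Complex.normSq_eq_conj_mul_self]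
    rfl
  simp only [h2] at h1
  rw [integral_complex_ofReal] at h1
  have h3 : ∫ x, ‖a x‖ ^ 2 ∂μ = 0 := by exact_mod_cast h1.symm
  have hint : Integrable (fun x => ‖a x‖ ^ 2) μ := by
    have hc : Continuous fun x => ‖a x‖ ^ 2 := by fun_prop
    exact hc.integrable_of_hasCompactSupport (HasCompactSupport.of_compactSpace _)
  rw [integral_eq_zero_iff_of_nonneg (fun x => by positivity) hint] at h3
  filter_upwards [h3] with x hx
  simpa using hx

variable (A : ℕ → Submodule ℂ C(X, ℂ))

/-- The ranges of the graded projections. -/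
def gradedSpace : ℕ → Submodule ℂ (GNSSpace μ)
  | 0 => filtH μ A 0
  | n + 1 => filtH μ A (n + 1) ⊓ (filtH μ A n)ᗮ

lemma gradedSpace_le : ∀ n, gradedSpace μ A n ≤ filtH μ A n
  | 0 => le_rfl
  | _ + 1 => inf_le_left

variable [∀ n, FiniteDimensional ℂ (A n)]

instance (n : ℕ) : FiniteDimensional ℂ (gradedSpace μ A n) :=
  Submodule.finiteDimensional_of_le (gradedSpace_le μ A n)

lemma finrank_gradedSpace_le (n : ℕ) :
    Module.finrank ℂ (gradedSpace μ A n) ≤ Module.finrank ℂ (A n) :=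
  (Submodule.finrank_mono (gradedSpace_le μ A n)).trans (Submodule.finrank_map_le _ _)

variable {A}

lemma gradedProj_eq (hA : Monotone A) (n : ℕ) :
    gradedProj μ A n = (gradedSpace μ A n).starProjection := by
  cases n with
  | zero => rfl
  | succ n =>
    have hle : filtH μ A n ≤ filtH μ A (n + 1) := Submodule.map_mono (hA n.le_succ)
    ext ξ
    simp only [gradedProj, _root_.sub_apply]
    refine (Submodule.eq_starProjection_of_mem_orthogonal
      (K := gradedSpace μ A (n + 1)) ?_ ?_).symm
    · refine Submodule.mem_inf.2 ⟨?_, ?_⟩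
      · exact Submodule.sub_mem _ (Submodule.starProjection_apply_mem _ _)
          (hle (Submodule.starProjection_apply_mem _ _))
      · have h1 : ξ - (filtH μ A n).starProjection ξ ∈ (filtH μ A n)ᗮ :=
          Submodule.sub_starProjection_mem_orthogonal ξ
        have h2 : ξ - (filtH μ A (n + 1)).starProjection ξ ∈ (filtH μ A n)ᗮ :=
          Submodule.orthogonal_le hle (Submodule.sub_starProjection_mem_orthogonal ξ)
        have := Submodule.sub_mem _ h1 h2
        rwa [sub_sub_sub_cancel_left] at this
    · have h1 : ξ - (filtH μ A (n + 1)).starProjection ξ ∈ (gradedSpace μ A (n + 1))ᗮ :=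
        Submodule.orthogonal_le inf_le_left (Submodule.sub_starProjection_mem_orthogonal ξ)
      have h2 : (filtH μ A n).starProjection ξ ∈ (gradedSpace μ A (n + 1))ᗮ :=
        Submodule.orthogonal_le inf_le_right (Submodule.le_orthogonal_orthogonal _
          (Submodule.starProjection_apply_mem _ _))
      have := Submodule.add_mem _ h1 h2
      rwa [sub_add] at this

/-- The coefficients of the zeta function. -/
def zetaCoeff (A : ℕ → Submodule ℂ C(X, ℂ)) [∀ n, FiniteDimensional ℂ (A n)] (a : C(X, ℂ))
    (n : ℕ) : ℂ :=
  compressionTrace ((measureState μ).gnsStarAlgHom a) (gradedSpace μ A n)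

lemma norm_zetaCoeff_le (a : C(X, ℂ)) (n : ℕ) :
    ‖zetaCoeff μ A a n‖ ≤ Module.finrank ℂ (A n) * ‖(measureState μ).gnsStarAlgHom a‖ := by
  refine (norm_compressionTrace_le _ _).trans (mul_le_mul_of_nonneg_right ?_ (norm_nonneg _))
  exact_mod_cast finrank_gradedSpace_le μ A n

/-- `H_0` is spanned by the unit vector `1`, and `⟨1, a 1⟩` is the state at `a`. -/
lemma zetaCoeff_zero (h0 : A 0 = ℂ ∙ 1) (a : C(X, ℂ)) :
    zetaCoeff μ A a 0 = ∫ x, a x ∂μ := by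
  have hV : gradedSpace μ A 0 = ℂ ∙ toGNS μ 1 := by
    rw [gradedSpace, filtH, h0, Submodule.map_span, image_singleton]
  rw [zetaCoeff, compressionTrace_span_singleton _ _ (norm_toGNS_one μ) hV, gnsStarAlgHom_toGNS,
    inner_toGNS]
  simp

lemma zetaCoeff_one (n : ℕ) :
    zetaCoeff μ A 1 n = Module.finrank ℂ (gradedSpace μ A n) := by
  rw [zetaCoeff, map_one]
  exact compressionTrace_id _

/-- The zeta function as a Dirichlet series. -/
lemma spectralZeta_eq_tsum (hA : Monotone A) {s : ℂ} (h1 : ∀ n, 1 ≤ Module.finrank ℂ (A n))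
    (hs : Summable fun n => ‖((|diracEigenvalue A n| : ℝ) : ℂ) ^ s‖ * Module.finrank ℂ (A n))
    (a : C(X, ℂ)) : spectralZeta μ A a s =
      ∑' n, ((|diracEigenvalue A n| : ℝ) : ℂ) ^ s * zetaCoeff μ A a n := by
  have h := hasTrace_comp_tsum ((measureState μ).gnsStarAlgHom a) (gradedSpace μ A)
    (c := fun n => ((|diracEigenvalue A n| : ℝ) : ℂ) ^ s)
    (d := fun n => (Module.finrank ℂ (A n) : ℝ))
    (fun n => by exact_mod_cast finrank_gradedSpace_le μ A n) (fun n => by exact_mod_cast h1 n) hs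
  simp only [← gradedProj_eq μ hA] at h
  exact h.opTrace_eq

end ZetaExpansion

/-! ## Recovering coefficients from Dirichlet series -/

section Asymptotics

/-- The leading coefficient of a general Dirichlet series. -/
lemma tendsto_pow_mul_tsum {L : ℕ → ℝ} {c : ℕ → ℂ} (hL0 : 0 < L 0) (hL : StrictMono L)
    (hc : Summable fun n => ‖c n‖ / L n) :
    Tendsto (fun k : ℕ => ((L 0 : ℝ) : ℂ) ^ k * ∑' n, (((L n : ℝ) : ℂ) ^ k)⁻¹ * c n) atTop
      (𝓝 (c 0)) := by
  have hpos : ∀ n, 0 < L n := fun n => hL0.trans_le (hL.monotone n.zero_le)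
  have h : Tendsto (fun k : ℕ => ∑' n, ((L 0 / L n : ℝ) : ℂ) ^ k * c n) atTop
      (𝓝 (∑' n, if n = 0 then c 0 else 0)) := by
    -- After normalisation the ratio `L 0 / L n` is `1` for `n = 0` and less than `1` otherwise; for
    -- `k ≥ 1` the norms of the terms are at most those for `k = 1`.
    refine tendsto_tsum_of_dominated_convergence (bound := fun n => L 0 * (‖c n‖ / L n))
      (hc.mul_left _) (fun n => ?_) ?_
    · by_cases hn : n = 0
      · subst hn
        simp [hL0.ne']
      · rw [if_neg hn]
        have h1 : ‖((L 0 / L n : ℝ) : ℂ)‖ < 1 := by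
          rw [Complex.norm_real, Real.norm_of_nonneg (div_nonneg hL0.le (hpos n).le),
            div_lt_one (hpos n)]
          exact hL (Nat.pos_of_ne_zero hn)
        simpa using (tendsto_pow_atTop_nhds_zero_of_norm_lt_one h1).mul_const (c n)
    · filter_upwards [eventually_ge_atTop 1] with k hk n
      have h0 : 0 ≤ L 0 / L n := div_nonneg hL0.le (hpos n).le
      have h1 : L 0 / L n ≤ 1 := (div_le_one (hpos n)).2 (hL.monotone n.zero_le)
      rw [norm_mul, norm_pow, Complex.norm_real, Real.norm_of_nonneg h0]
      calc (L 0 / L n) ^ k * ‖c n‖ ≤ (L 0 / L n) * ‖c n‖ :=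
            mul_le_mul_of_nonneg_right (pow_le_of_le_one h0 h1 (by omega)) (norm_nonneg _)
        _ = L 0 * (‖c n‖ / L n) := by ring
  rw [tsum_ite_eq] at h
  refine h.congr fun k => ?_
  rw [← tsum_mul_left]
  refine tsum_congr fun n => ?_
  rw [Complex.ofReal_div, div_pow, div_eq_mul_inv, mul_assoc]

lemma summable_pow_mul {L : ℕ → ℝ} {c : ℕ → ℂ} (hL : ∀ n, 1 ≤ L n)
    (hc : Summable fun n => ‖c n‖ / L n) {k : ℕ} (hk : 1 ≤ k) :
    Summable fun n => (((L n : ℝ) : ℂ) ^ k)⁻¹ * c n := by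
  refine Summable.of_norm_bounded hc fun n => ?_
  have hpos : 0 < L n := one_pos.trans_le (hL n)
  rw [norm_mul, norm_inv, norm_pow, Complex.norm_real, Real.norm_of_nonneg hpos.le, div_eq_mul_inv,
    mul_comm]
  refine mul_le_mul_of_nonneg_left ?_ (norm_nonneg _)
  exact inv_anti₀ hpos (le_self_pow₀ (hL n) (by omega))

/-- The second exponent of a Dirichlet series with leading term `1` is determined by its values. -/
lemma not_lt_of_tsum_eq {L L' : ℕ → ℝ} {c c' : ℕ → ℂ} (hL0 : L 0 = 1) (hL0' : L' 0 = 1)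
    (hL : StrictMono L) (hL' : StrictMono L')
    (hc : Summable fun n => ‖c n‖ / L n) (hc' : Summable fun n => ‖c' n‖ / L' n)
    (h0 : c 0 = c' 0) (h1 : c 1 ≠ 0)
    (heq : ∀ᶠ k : ℕ in atTop, ∑' n, (((L n : ℝ) : ℂ) ^ k)⁻¹ * c n =
      ∑' n, (((L' n : ℝ) : ℂ) ^ k)⁻¹ * c' n) : ¬ L 1 < L' 1 := by
  intro hlt
  have hge : ∀ n, 1 ≤ L n := fun n => hL0 ▸ hL.monotone n.zero_le
  have hge' : ∀ n, 1 ≤ L' n := fun n => hL0' ▸ hL'.monotone n.zero_le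
  have hp : 0 < L 1 := one_pos.trans_le (hge 1)
  have hp' : 0 < L' 1 := one_pos.trans_le (hge' 1)
  -- Without the equal leading terms and multiplied by `(L 1) ^ k`, the first series tends to `c 1`;
  -- the second acquires the factor `(L 1 / L' 1) ^ k` and tends to `0`.
  have t1 := tendsto_pow_mul_tsum (L := fun n => L (n + 1)) (c := fun n => c (n + 1)) hp
    (fun _ _ h => hL (Nat.add_lt_add_right h 1)) ((summable_nat_add_iff 1).2 hc)
  have t2 := tendsto_pow_mul_tsum (L := fun n => L' (n + 1)) (c := fun n => c' (n + 1)) hp'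
    (fun _ _ h => hL' (Nat.add_lt_add_right h 1)) ((summable_nat_add_iff 1).2 hc')
  have hq : Tendsto (fun k : ℕ => ((L 1 / L' 1 : ℝ) : ℂ) ^ k) atTop (𝓝 0) := by
    refine tendsto_pow_atTop_nhds_zero_of_norm_lt_one ?_
    rw [Complex.norm_real, Real.norm_of_nonneg (div_nonneg hp.le hp'.le), div_lt_one hp']
    exact hlt
  have t3 := hq.mul t2
  rw [zero_mul] at t3
  refine h1 (tendsto_nhds_unique t1 (t3.congr' ?_))
  filter_upwards [heq, eventually_ge_atTop 1] with k hk hk1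
  rw [(summable_pow_mul hge hc hk1).tsum_eq_zero_add,
    (summable_pow_mul hge' hc' hk1).tsum_eq_zero_add, hL0, hL0', h0, add_right_inj] at hk
  have hne : ((L' 1 : ℝ) : ℂ) ≠ 0 := Complex.ofReal_ne_zero.2 hp'.ne'
  simp only [zero_add]
  rw [hk, Complex.ofReal_div, div_pow, ← mul_assoc, div_mul_cancel₀ _ (pow_ne_zero k hne)]

end Asymptotics

/-! ## The zeta functions of a Schottky group -/

section SchottkyZeta

open FreeGroup

variable {g : ℕ} {ρ : FreeGroup (Fin g) →* PGL(2, ℂ)} {x₀ : RSphere}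
  {μ : Measure (limitSet ρ.range)}

namespace IsSchottkyRep

/-- Conformality is formulated on the sphere; this moves sets of ends there. -/
lemma map_val_image (hρ : IsSchottkyRep ρ) (hx₀ : x₀ ∉ limitSet ρ.range)
    (w : FreeGroup (Fin g)) :
    IsCompact (Subtype.val '' ends ρ x₀ w) ∧
      μ.map Subtype.val (Subtype.val '' ends ρ x₀ w) = μ (ends ρ x₀ w) := by
  have hc : IsCompact (Subtype.val '' ends ρ x₀ w) :=
    (hρ.isClopen_ends hx₀ w).isClosed.isCompact.image continuous_subtype_val
  refine ⟨hc, ?_⟩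
  rw [Measure.map_apply measurable_subtype_coe hc.isClosed.measurableSet,
    preimage_image_eq _ Subtype.val_injective]

lemma integral_charFun (hρ : IsSchottkyRep ρ) (hx₀ : x₀ ∉ limitSet ρ.range)
    (w : FreeGroup (Fin g)) :
    ∫ x, hρ.charFun hx₀ w x ∂μ = (μ.real (ends ρ x₀ w) : ℂ) := by
  simp only [charFun_apply]
  rw [integral_indicator (hρ.isClopen_ends hx₀ w).isOpen.measurableSet]
  simp

variable [IsProbabilityMeasure μ]

/-- A Patterson-Sullivan measure charges the ends of at least two letters. -/
lemma exists_two_letters (hg : 2 ≤ g) (hρ : IsSchottkyRep ρ) (hx₀ : x₀ ∉ limitSet ρ.range)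
    (hμ : IsPattersonSullivan ρ.range μ) :
    ∃ l m : Fin g × Bool, l ≠ m ∧ μ (ends ρ x₀ (FreeGroup.mk [l])) ≠ 0 ∧
      μ (ends ρ x₀ (FreeGroup.mk [m])) ≠ 0 := by
  obtain ⟨l, hl⟩ : ∃ l : Fin g × Bool, μ (ends ρ x₀ (FreeGroup.mk [l])) ≠ 0 := by
    by_contra! h
    have h1 : (⋃ l : Fin g × Bool, ends ρ x₀ (FreeGroup.mk [l])) = univ := by
      refine eq_univ_of_forall fun p => ?_
      obtain ⟨w, hn, hw⟩ := hρ.exists_norm_mem_ends hx₀ 1 p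
      obtain ⟨l, hl⟩ := List.length_eq_one_iff.1 hn
      exact mem_iUnion.2 ⟨l, by rwa [← hl, FreeGroup.mk_toWord]⟩
    have h2 := measure_iUnion_null h
    rw [h1, measure_univ] at h2
    exact one_ne_zero h2
  have : Nontrivial (Fin g) := Fin.nontrivial_iff_two_le.2 hg
  -- A generator of different index cannot cancel against `l`.
  obtain ⟨i, hi⟩ := exists_ne l.1
  refine ⟨l, (i, true), fun h => hi (by rw [h]), hl, fun hm => hl ?_⟩
  have hred : FreeGroup.IsReduced [(i, true), l] := by
    rw [isReduced_cons_cons]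
    exact ⟨fun h => absurd h hi, IsReduced.singleton⟩
  obtain ⟨hcl, hEl⟩ := hρ.map_val_image (μ := μ) hx₀ (FreeGroup.mk [l])
  obtain ⟨-, hEm⟩ := hρ.map_val_image (μ := μ) hx₀ (FreeGroup.mk [(i, true)])
  set γ := ρ (FreeGroup.mk [(i, true)]) with hγ
  set E := Subtype.val '' ends ρ x₀ (FreeGroup.mk [l]) with hE
  have hsub : (γ • ·) '' E ⊆ Subtype.val '' ends ρ x₀ (FreeGroup.mk [(i, true)]) := by
    rintro _ ⟨_, ⟨p, hp, rfl⟩, rfl⟩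
    obtain ⟨q, hq, hqp⟩ := hρ.smul_mem_ends hx₀ hred hp
    exact ⟨q, hq, hqp⟩
  have hnull : μ.map Subtype.val ((γ • ·) '' E) = 0 := by
    refine measure_mono_null hsub ?_
    rw [hEm, hm]
  have hmeas : MeasurableSet ((γ • ·) '' E) :=
    (hcl.image (continuous_const_smul γ)).isClosed.measurableSet
  -- Conformality enters only through quasi-invariance: if `γ E` is null, so is its image `E` under
  -- `γ⁻¹`, whatever the derivative.
  have h := hμ γ⁻¹ (Subgroup.inv_mem _ ⟨_, rfl⟩) _ hmeas
  rw [setLIntegral_measure_zero _ _ hnull, image_image] at h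
  simp only [inv_smul_smul, image_id'] at h
  rw [← hEl, h]

/-- Otherwise the characteristic function of the ends of a letter would be almost everywhere
constant, although it takes the values `1` and `0` on two sets of positive measure. -/
lemma finrank_gradedSpace_one_ne_zero (hg : 2 ≤ g) (hρ : IsSchottkyRep ρ)
    (hx₀ : x₀ ∉ limitSet ρ.range) (hμ : IsPattersonSullivan ρ.range μ) :
    Module.finrank ℂ (gradedSpace μ (locConst ρ x₀) 1) ≠ 0 := by
  intro h0
  obtain ⟨l, m, hlm, hl, hm⟩ := hρ.exists_two_letters hg hx₀ hμ
  have hbot : gradedSpace μ (locConst ρ x₀) 1 = ⊥ := Submodule.finrank_eq_zero.1 h0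
  set f := hρ.charFun hx₀ (FreeGroup.mk [l]) with hf
  have hf1 : toGNS μ f ∈ filtH μ (locConst ρ x₀) 1 :=
    Submodule.mem_map_of_mem (hρ.charFun_mem_locConst hx₀ (by simp [FreeGroup.norm]))
  have hle : filtH μ (locConst ρ x₀) 0 ≤ filtH μ (locConst ρ x₀) 1 :=
    Submodule.map_mono (monotone_locConst ρ x₀ zero_le_one)
  have hdiff : toGNS μ f - (filtH μ (locConst ρ x₀) 0).starProjection (toGNS μ f) ∈
      gradedSpace μ (locConst ρ x₀) 1 :=
    Submodule.mem_inf.2 ⟨Submodule.sub_mem _ hf1 (hle (Submodule.starProjection_apply_mem _ _)),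
      Submodule.sub_starProjection_mem_orthogonal _⟩
  rw [hbot, Submodule.mem_bot, sub_eq_zero] at hdiff
  have hf0 : toGNS μ f ∈ filtH μ (locConst ρ x₀) 0 :=
    hdiff ▸ Submodule.starProjection_apply_mem _ _
  rw [filtH, hρ.locConst_zero hx₀] at hf0
  obtain ⟨b, hb, hbf⟩ := hf0
  obtain ⟨c, rfl⟩ := Submodule.mem_span_singleton.1 hb
  have hz : toGNS μ (f - c • 1) = 0 := by rw [map_sub, ← hbf, sub_self]
  have hae := ae_eq_zero_of_toGNS_eq_zero μ hz
  have key : ∀ {E : Set (limitSet ρ.range)}, μ E ≠ 0 → ∃ p ∈ E, (f - c • 1) p = 0 := by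
    intro E hE
    by_contra! h
    exact hE (measure_mono_null h hae)
  obtain ⟨p, hp, hp0⟩ := key hl
  obtain ⟨q, hq, hq0⟩ := key hm
  have hql : q ∉ ends ρ x₀ (FreeGroup.mk [l]) := fun hql => by
    have := congrArg FreeGroup.toWord (hρ.eq_of_mem_ends hx₀ (by simp [FreeGroup.norm]) hql hq)
    rw [toWord_letter, toWord_letter] at this
    exact hlm (List.singleton_inj.1 this)
  simp only [ContinuousMap.sub_apply, ContinuousMap.smul_apply, ContinuousMap.one_apply, hf,
    charFun_apply, indicator_of_mem hp, indicator_of_notMem hql, Pi.one_apply, smul_eq_mul,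
    mul_one] at hp0 hq0
  rw [zero_sub, neg_eq_zero] at hq0
  rw [hq0, sub_zero] at hp0
  exact one_ne_zero hp0

lemma lt_finrank_locConst (hg : 2 ≤ g) (hρ : IsSchottkyRep ρ) (hx₀ : x₀ ∉ limitSet ρ.range)
    (n : ℕ) : n + 1 ≤ Module.finrank ℂ (locConst ρ x₀ n) := by
  have : NeZero g := ⟨by omega⟩
  have h : n + Module.finrank ℂ (locConst ρ x₀ 0) ≤ Module.finrank ℂ (locConst ρ x₀ n) :=
    (hρ.strictMono_finrank_locConst hg hx₀).add_le_nat n 0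
  rw [hρ.finrank_locConst_zero hx₀] at h
  omega

lemma strictMono_diracEigenvalue (hg : 2 ≤ g) (hρ : IsSchottkyRep ρ)
    (hx₀ : x₀ ∉ limitSet ρ.range) : StrictMono (diracEigenvalue (locConst ρ x₀)) := fun _ _ h =>
  pow_lt_pow_left₀ (Nat.cast_lt.2 (hρ.strictMono_finrank_locConst hg hx₀ h)) (Nat.cast_nonneg _)
    three_ne_zero

lemma diracEigenvalue_zero (hg : 2 ≤ g) (hρ : IsSchottkyRep ρ) (hx₀ : x₀ ∉ limitSet ρ.range) :
    diracEigenvalue (locConst ρ x₀) 0 = 1 := by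
  have : NeZero g := ⟨by omega⟩
  rw [diracEigenvalue, hρ.finrank_locConst_zero hx₀]
  simp

lemma diracEigenvalue_one (hg : 2 ≤ g) (hρ : IsSchottkyRep ρ) (hx₀ : x₀ ∉ limitSet ρ.range) :
    diracEigenvalue (locConst ρ x₀) 1 = (2 * g) ^ 3 := by
  have : NeZero g := ⟨by omega⟩
  rw [diracEigenvalue, hρ.finrank_locConst_one hx₀]
  push_cast
  rfl

/-- With cubes as eigenvalues the quotient is `(dim A n)⁻²`, and `dim A n ≥ n + 1`; so the Dirichlet
series already converges absolutely at `s = -1`. -/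
lemma summable_finrank_div (hg : 2 ≤ g) (hρ : IsSchottkyRep ρ) (hx₀ : x₀ ∉ limitSet ρ.range) :
    Summable fun n => (Module.finrank ℂ (locConst ρ x₀ n) : ℝ) /
      diracEigenvalue (locConst ρ x₀) n := by
  have h := (summable_nat_add_iff 1).2 (Real.summable_nat_pow_inv.2 one_lt_two)
  refine h.of_nonneg_of_le (fun n => by unfold diracEigenvalue; positivity) fun n => ?_
  have h1 : ((n + 1 : ℕ) : ℝ) ≤ Module.finrank ℂ (locConst ρ x₀ n) :=
    Nat.cast_le.2 (hρ.lt_finrank_locConst hg hx₀ n)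
  have hp : (0 : ℝ) < (n + 1 : ℕ) := Nat.cast_pos.2 n.succ_pos
  have hd := hp.trans_le h1
  have : (Module.finrank ℂ (locConst ρ x₀ n) : ℝ) / diracEigenvalue (locConst ρ x₀) n =
      ((Module.finrank ℂ (locConst ρ x₀ n) : ℝ) ^ 2)⁻¹ := by
    unfold diracEigenvalue
    field_simp
  rw [this]
  exact inv_anti₀ (pow_pos hp 2) (pow_le_pow_left₀ hp.le h1 2)

lemma one_le_diracEigenvalue (hg : 2 ≤ g) (hρ : IsSchottkyRep ρ) (hx₀ : x₀ ∉ limitSet ρ.range)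
    (n : ℕ) : 1 ≤ diracEigenvalue (locConst ρ x₀) n := by
  rw [← hρ.diracEigenvalue_zero hg hx₀]
  exact (hρ.strictMono_diracEigenvalue hg hx₀).monotone n.zero_le

lemma summable_zetaCoeff (hg : 2 ≤ g) (hρ : IsSchottkyRep ρ) (hx₀ : x₀ ∉ limitSet ρ.range)
    (a : C(limitSet ρ.range, ℂ)) :
    Summable fun n => ‖zetaCoeff μ (locConst ρ x₀) a n‖ / diracEigenvalue (locConst ρ x₀) n := by
  refine ((hρ.summable_finrank_div hg hx₀).mul_right
    ‖(measureState μ).gnsStarAlgHom a‖).of_nonneg_of_le (fun n => ?_) fun n => ?_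
  · exact div_nonneg (norm_nonneg _) (zero_le_one.trans (hρ.one_le_diracEigenvalue hg hx₀ n))
  · rw [div_mul_eq_mul_div]
    exact div_le_div_of_nonneg_right (norm_zetaCoeff_le μ a n)
      (zero_le_one.trans (hρ.one_le_diracEigenvalue hg hx₀ n))

/-- The values of the zeta function at negative integers. -/
lemma schottkyZeta_neg_natCast (hg : 2 ≤ g) (hρ : IsSchottkyRep ρ)
    (hx₀ : x₀ ∉ limitSet ρ.range) (a : C(limitSet ρ.range, ℂ)) {k : ℕ} (hk : 1 ≤ k) :
    schottkyZeta ρ x₀ μ a (-(k : ℂ)) =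
      ∑' n, (((diracEigenvalue (locConst ρ x₀) n : ℝ) : ℂ) ^ k)⁻¹ *
        zetaCoeff μ (locConst ρ x₀) a n := by
  have hpow : ∀ n, ((|diracEigenvalue (locConst ρ x₀) n| : ℝ) : ℂ) ^ (-(k : ℂ)) =
      (((diracEigenvalue (locConst ρ x₀) n : ℝ) : ℂ) ^ k)⁻¹ := fun n => by
    rw [abs_of_pos (one_pos.trans_le (hρ.one_le_diracEigenvalue hg hx₀ n)), Complex.cpow_neg,
      Complex.cpow_natCast]
  have h1 : ∀ n, 1 ≤ Module.finrank ℂ (locConst ρ x₀ n) := fun n =>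
    (Nat.le_add_left 1 n).trans (hρ.lt_finrank_locConst hg hx₀ n)
  rw [schottkyZeta, spectralZeta_eq_tsum μ (monotone_locConst ρ x₀) h1]
  · simp only [hpow]
  · simp only [hpow]
    refine (summable_pow_mul (c := fun n => (Module.finrank ℂ (locConst ρ x₀ n) : ℂ))
      (hρ.one_le_diracEigenvalue hg hx₀) ?_ hk).norm.congr fun n => ?_
    · simpa using hρ.summable_finrank_div hg hx₀
    · rw [norm_mul, Complex.norm_natCast]

/-- The zeta function of `a` determines the integral of `a`. -/
lemma tendsto_schottkyZeta (hg : 2 ≤ g) (hρ : IsSchottkyRep ρ) (hx₀ : x₀ ∉ limitSet ρ.range)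
    (a : C(limitSet ρ.range, ℂ)) :
    Tendsto (fun k : ℕ => schottkyZeta ρ x₀ μ a (-(k : ℂ))) atTop (𝓝 (∫ x, a x ∂μ)) := by
  have h0 := hρ.diracEigenvalue_zero hg hx₀
  have h := tendsto_pow_mul_tsum (h0 ▸ one_pos) (hρ.strictMono_diracEigenvalue hg hx₀)
    (hρ.summable_zetaCoeff (μ := μ) hg hx₀ a)
  rw [zetaCoeff_zero μ (hρ.locConst_zero hx₀)] at h
  refine h.congr' ?_
  filter_upwards [eventually_ge_atTop 1] with k hk
  rw [hρ.schottkyZeta_neg_natCast hg hx₀ a hk, h0]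
  simp

end IsSchottkyRep

lemma ZetaEq.eventually {ζ₁ ζ₂ : ℂ → ℂ} (h : ZetaEq ζ₁ ζ₂) :
    ∀ᶠ k : ℕ in atTop, ζ₁ (-(k : ℂ)) = ζ₂ (-(k : ℂ)) := by
  obtain ⟨σ, hσ⟩ := h
  filter_upwards [tendsto_natCast_atTop_atTop.eventually_gt_atTop (-σ)] with k hk
  refine hσ _ ?_
  rw [Complex.neg_re, Complex.natCast_re]
  linarith

lemma ZetaEq.symm {ζ₁ ζ₂ : ℂ → ℂ} (h : ZetaEq ζ₁ ζ₂) : ZetaEq ζ₂ ζ₁ :=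
  h.imp fun _ hσ s hs => (hσ s hs).symm

/-- The zeta function of the unit determines the rank. -/
lemma not_lt_of_zetaEq {g₁ g₂ : ℕ} (hg₁ : 2 ≤ g₁) (hg₂ : 2 ≤ g₂)
    {ρ₁ : FreeGroup (Fin g₁) →* PGL(2, ℂ)} {ρ₂ : FreeGroup (Fin g₂) →* PGL(2, ℂ)}
    (hρ₁ : IsSchottkyRep ρ₁) (hρ₂ : IsSchottkyRep ρ₂) {x₁ x₂ : RSphere}
    (hx₁ : x₁ ∉ limitSet ρ₁.range) (hx₂ : x₂ ∉ limitSet ρ₂.range)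
    {μ₁ : Measure (limitSet ρ₁.range)} [IsProbabilityMeasure μ₁]
    {μ₂ : Measure (limitSet ρ₂.range)} [IsProbabilityMeasure μ₂]
    (hμ₁ : IsPattersonSullivan ρ₁.range μ₁)
    (h : ZetaEq (schottkyZeta ρ₁ x₁ μ₁ 1) (schottkyZeta ρ₂ x₂ μ₂ 1)) : ¬ g₁ < g₂ := by
  intro hlt
  refine not_lt_of_tsum_eq (hρ₁.diracEigenvalue_zero hg₁ hx₁) (hρ₂.diracEigenvalue_zero hg₂ hx₂)
    (hρ₁.strictMono_diracEigenvalue hg₁ hx₁) (hρ₂.strictMono_diracEigenvalue hg₂ hx₂)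
    (hρ₁.summable_zetaCoeff (μ := μ₁) hg₁ hx₁ 1) (hρ₂.summable_zetaCoeff (μ := μ₂) hg₂ hx₂ 1)
    ?_ ?_ ?_ ?_
  · rw [zetaCoeff_zero _ (hρ₁.locConst_zero hx₁), zetaCoeff_zero _ (hρ₂.locConst_zero hx₂)]
    simp
  · rw [zetaCoeff_one]
    exact Nat.cast_ne_zero.2 (hρ₁.finrank_gradedSpace_one_ne_zero hg₁ hx₁ hμ₁)
  · filter_upwards [h.eventually, eventually_ge_atTop 1] with k hk hk1
    rwa [hρ₁.schottkyZeta_neg_natCast hg₁ hx₁ 1 hk1,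
      hρ₂.schottkyZeta_neg_natCast hg₂ hx₂ 1 hk1] at hk
  · rw [hρ₁.diracEigenvalue_one hg₁ hx₁, hρ₂.diracEigenvalue_one hg₂ hx₂]
    gcongr

end SchottkyZeta

end

theorem theorem2p1 (g₁ g₂ : ℕ) (hg₁ : 2 ≤ g₁) (hg₂ : 2 ≤ g₂)
    (ρ₁ : FreeGroup (Fin g₁) →* PGL(2, ℂ)) (ρ₂ : FreeGroup (Fin g₂) →* PGL(2, ℂ))
    (hρ₁ : IsSchottkyRep ρ₁) (hρ₂ : IsSchottkyRep ρ₂)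
    (x₁ x₂ : RSphere) (hx₁ : x₁ ∉ limitSet ρ₁.range) (hx₂ : x₂ ∉ limitSet ρ₂.range)
    (μ₁ : Measure (limitSet ρ₁.range)) [IsProbabilityMeasure μ₁]
    (μ₂ : Measure (limitSet ρ₂.range)) [IsProbabilityMeasure μ₂]
    (hμ₁ : IsPattersonSullivan ρ₁.range μ₁) (hμ₂ : IsPattersonSullivan ρ₂.range μ₂)
    (hζ_unit : ZetaEq (schottkyZeta ρ₁ x₁ μ₁ 1) (schottkyZeta ρ₂ x₂ μ₂ 1))
    (hζ : ∀ h : g₁ = g₂, ∀ a₁ ∈ locConstAll ρ₁ x₁, ∀ a₂ ∈ locConstAll ρ₂ x₂,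
      FloydIdentified h ρ₁ ρ₂ x₁ x₂ a₁ a₂ →
        ZetaEq (schottkyZeta ρ₁ x₁ μ₁ a₁) (schottkyZeta ρ₂ x₂ μ₂ a₂)) :
    ∃ h : g₁ = g₂, ∀ η : FreeGroup (Fin g₁),
      μ₁ (ends ρ₁ x₁ η) = μ₂ (ends ρ₂ x₂ (h ▸ η : FreeGroup (Fin g₂))) := by
  have h : g₁ = g₂ := le_antisymm
    (not_lt.1 (not_lt_of_zetaEq hg₂ hg₁ hρ₂ hρ₁ hx₂ hx₁ hμ₂ hζ_unit.symm))
    (not_lt.1 (not_lt_of_zetaEq hg₁ hg₂ hρ₁ hρ₂ hx₁ hx₂ hμ₁ hζ_unit))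
  refine ⟨h, ?_⟩
  subst h
  intro η
  have hid : FloydIdentified rfl ρ₁ ρ₂ x₁ x₂ (hρ₁.charFun hx₁ η) (hρ₂.charFun hx₂ η) := by
    intro v p₁ p₂ h₁ h₂
    have heq : p₁ ∈ ends ρ₁ x₁ η ↔ p₂ ∈ ends ρ₂ x₂ η :=
      (hρ₁.mem_ends_iff_isInitialWord hx₁ h₁ η).trans
        (hρ₂.mem_ends_iff_isInitialWord hx₂ h₂ η).symm
    rw [IsSchottkyRep.charFun_apply, IsSchottkyRep.charFun_apply]
    by_cases hp : p₁ ∈ ends ρ₁ x₁ η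
    · rw [indicator_of_mem hp, indicator_of_mem (heq.1 hp)]
      rfl
    · rw [indicator_of_notMem hp, indicator_of_notMem (mt heq.2 hp)]
  have hz := hζ rfl _ (hρ₁.charFun_mem_locConstAll hx₁ η) _ (hρ₂.charFun_mem_locConstAll hx₂ η) hid
  -- The zeta functions agree at large negative integers, where they tend to the measures of the two
  -- sets of ends.
  have hlim := tendsto_nhds_unique
    ((hρ₁.tendsto_schottkyZeta (μ := μ₁) hg₁ hx₁ (hρ₁.charFun hx₁ η)).congr' hz.eventually)
    (hρ₂.tendsto_schottkyZeta (μ := μ₂) hg₁ hx₂ (hρ₂.charFun hx₂ η))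
  rw [hρ₁.integral_charFun, hρ₂.integral_charFun, Complex.ofReal_inj] at hlim
  exact (ENNReal.toReal_eq_toReal_iff' (measure_ne_top _ _) (measure_ne_top _ _)).1 hlim
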